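/- Let $P \subset \mathbb{R}^d$ be a $d$-dimensional parallelohedron, that is, a $d$-dimensional convex polytope whose translates tile $\mathbb{R}^d$ normally (face-to-face: any two cells of the tiling are either disjoint or meet in a common face), and let $\mathcal{T}_P$ be such a tiling. A scaling of $\mathcal{T}_P$ is a function $s$ that assigns a positive real number to every hyperface (that is, $(d-1)$-dimensional face) of the tiling. For a $(d-2)$-dimensional face $G$ of the tiling let $F_1, \dots, F_k$ be all hyperfaces of the tiling that contain $G$; choose one of the two directions of traversal around $G$ (in the two-dimensional plane orthogonal to the affine hull of $G$), and let $\mathbf{n}_i$ be the unit normal to $F_i$ that points in this direction. The torsion of $s$ around $G$ is $$\Delta_s(G) = \sum_{i=1}^k s(F_i)\,\mathbf{n}_i ,$$ which is defined up to sign. The scaling $s$ is called canonical if $\Delta_s(G) = 0$ for every $(d-2)$-face $G$ of the tiling, and translation invariant if $s(F + v) = s(F)$ for every hyperface $F$ and every vector $v$ such that the translation by $v$ maps $\mathcal{T}_P$ onto itself. If $\mathcal{T}_P$ has a canonical scaling, then $\mathcal{T}_P$ also has a canonical scaling that is translation invariant. -/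

import Mathlib

open scoped Pointwise

namespace Parallelohedra

/-- `F` is a nonempty face (of any dimension, the improper face `C` included) of the convex
polytope `C`: the set of maximizers on `C` of some linear functional. -/
def IsFace {d : ℕ} (C F : Set (EuclideanSpace ℝ (Fin d))) : Prop :=
  F.Nonempty ∧ IsExposed ℝ C F

/-- `P` is a `d`-dimensional convex polytope and `𝒯` is the set of cells of a normal
(face-to-face) tiling of `ℝ^d` by translates of `P`; thus `P` is a parallelohedron. -/
structure IsParallelohedronTiling {d : ℕ} (P : Set (EuclideanSpace ℝ (Fin d)))
    (𝒯 : Set (Set (EuclideanSpace ℝ (Fin d)))) : Prop where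
  polytope : ∃ V : Set (EuclideanSpace ℝ (Fin d)), V.Finite ∧ P = convexHull ℝ V
  full_dimensional : (interior P).Nonempty
  translates : ∀ C ∈ 𝒯, ∃ v : EuclideanSpace ℝ (Fin d), C = v +ᵥ P
  covers : ⋃₀ 𝒯 = Set.univ
  disjoint_interiors : ∀ C ∈ 𝒯, ∀ C' ∈ 𝒯, C ≠ C' → Disjoint (interior C) (interior C')
  face_to_face : ∀ C ∈ 𝒯, ∀ C' ∈ 𝒯, (C ∩ C').Nonempty →
    IsFace C (C ∩ C') ∧ IsFace C' (C ∩ C')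

/-- The faces of dimension `d - j` of the tiling `𝒯` of `ℝ^d` (none if `d < j`). -/
def facesOfCodim {d : ℕ} (𝒯 : Set (Set (EuclideanSpace ℝ (Fin d)))) (j : ℕ) :
    Set (Set (EuclideanSpace ℝ (Fin d))) :=
  {F | (∃ C ∈ 𝒯, IsFace C F) ∧ Module.finrank ℝ (vectorSpan ℝ F) + j = d}

/-- The hyperfaces, i.e. the `(d-1)`-dimensional faces, of the tiling. -/
abbrev hyperfaces {d : ℕ} (𝒯 : Set (Set (EuclideanSpace ℝ (Fin d)))) :
    Set (Set (EuclideanSpace ℝ (Fin d))) :=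
  facesOfCodim 𝒯 1

/-- `e 0, e 1` is an orthonormal basis of the two-dimensional plane complementary to the affine
hull of the `(d-2)`-face `G`. The rotation from `e 0` to `e 1` is one of the two directions of
traversal around `G`; the basis `e 1, e 0` gives the opposite one. -/
def IsTraversalFrame {d : ℕ} (G : Set (EuclideanSpace ℝ (Fin d)))
    (e : Fin 2 → EuclideanSpace ℝ (Fin d)) : Prop :=
  Orthonormal ℝ e ∧ Submodule.span ℝ (Set.range e) = (vectorSpan ℝ G)ᗮ

/-- `n` is the unit normal to the hyperface `F ⊇ G` that points in the direction of traversal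
around `G` given by `e`: in the plane of `e`, into which `F` is projected as a segment issuing
from the projection of `G`, each vector from the latter along the former makes with `n` a
positively oriented pair. -/
structure IsTraversalNormal {d : ℕ} (e : Fin 2 → EuclideanSpace ℝ (Fin d))
    (G F : Set (EuclideanSpace ℝ (Fin d))) (n : EuclideanSpace ℝ (Fin d)) : Prop where
  unit : ‖n‖ = 1
  normal : n ∈ (vectorSpan ℝ F)ᗮ
  oriented : ∀ y ∈ G, ∀ x ∈ F \ G,
    0 < inner ℝ (e 0) (x - y) * inner ℝ (e 1) n - inner ℝ (e 1) (x - y) * inner ℝ (e 0) n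

/-- `τ` is the torsion of the scaling `s` around the `(d-2)`-face `G`, for one of the two
directions of traversal (`F` lists all hyperfaces of the tiling that contain `G`; the sum does
not depend on the order). The torsion is defined up to sign. -/
def IsTorsion {d : ℕ} (𝒯 : Set (Set (EuclideanSpace ℝ (Fin d)))) (s : hyperfaces 𝒯 → ℝ)
    (G : Set (EuclideanSpace ℝ (Fin d))) (τ : EuclideanSpace ℝ (Fin d)) : Prop :=
  ∃ e : Fin 2 → EuclideanSpace ℝ (Fin d), IsTraversalFrame G e ∧
    ∃ (k : ℕ) (F : Fin k ≃ {F : hyperfaces 𝒯 // G ⊆ (F : Set (EuclideanSpace ℝ (Fin d)))})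
      (n : Fin k → EuclideanSpace ℝ (Fin d)),
      (∀ i, IsTraversalNormal e G ((F i).1 : Set (EuclideanSpace ℝ (Fin d))) (n i)) ∧
      τ = ∑ i, s (F i).1 • n i

/-- A canonical scaling of the tiling: a positive function on the hyperfaces with zero torsion
around every `(d-2)`-face. -/
def IsCanonicalScaling {d : ℕ} (𝒯 : Set (Set (EuclideanSpace ℝ (Fin d))))
    (s : hyperfaces 𝒯 → ℝ) : Prop :=
  (∀ F, 0 < s F) ∧ ∀ G ∈ facesOfCodim 𝒯 2, IsTorsion 𝒯 s G 0

/-- The vectors of the translations that map the tiling onto itself. -/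
def translationVectors {d : ℕ} (𝒯 : Set (Set (EuclideanSpace ℝ (Fin d)))) :
    Set (EuclideanSpace ℝ (Fin d)) :=
  {v | (fun C : Set (EuclideanSpace ℝ (Fin d)) => v +ᵥ C) '' 𝒯 = 𝒯}

/-- The scaling takes the same value on `F` and on `v + F` for every hyperface `F` and every
translation by `v` that preserves the tiling. -/
def IsTranslationInvariant {d : ℕ} (𝒯 : Set (Set (EuclideanSpace ℝ (Fin d))))
    (s : hyperfaces 𝒯 → ℝ) : Prop :=
  ∀ v ∈ translationVectors 𝒯, ∀ F F' : hyperfaces 𝒯,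
    (F' : Set (EuclideanSpace ℝ (Fin d))) = v +ᵥ (F : Set (EuclideanSpace ℝ (Fin d))) →
      s F' = s F

end Parallelohedra

/-!
The cells are centrally symmetric, as Minkowski has shown: translates of a cell `C` pack space with
density one, so a volume count gives `vol (C - C) ≤ 2 ^ d * vol C`, and this is the equality case of
the Brunn–Minkowski inequality for `C` and `-C`. Hence the reflection in the center of `C` is a
symmetry of the tiling, and the sum of the given canonical scaling and its mirror image is a
canonical scaling that takes equal values on opposite hyperfaces of `C`.

Every hyperface of the tiling is parallel to some hyperface of `C`. Give it the value of that
hyperface. Translations preserve the resulting scaling, and it agrees on each cell with a translate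
of a canonical scaling. This makes the torsion around a `(d-2)`-face `G` vanish: the normals around
`G` form a plane fan in which either each vector has an opposite one, so that the terms cancel in
parallel pairs, or there are just three vectors. In the second case any two linear relations between
the normals are proportional, so the values on two consecutive hyperfaces, which lie on a common
cell, determine the relation.
-/

namespace Parallelohedra

section BrunnMinkowski

open MeasureTheory Set

theorem volume_add_volume_le_volume_add {A B : Set ℝ} (hA : IsCompact A) (hB : IsCompact B)
    (hA' : A.Nonempty) (hB' : B.Nonempty) : volume A + volume B ≤ volume (A + B) := by
  have ha := hA.sSup_mem hA'
  have hb := hB.sInf_mem hB'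
  set a := sSup A
  set b := sInf B
  have hdisj : AEDisjoint volume ((· + b) '' A) ((a + ·) '' B) := by
    refine measure_mono_null (t := {a + b}) ?_ (by simp)
    rintro _ ⟨⟨x, hx, rfl⟩, y, hy, hxy : a + y = x + b⟩
    have hxa : x ≤ a := le_csSup hA.bddAbove hx
    have hby : b ≤ y := csInf_le hB.bddBelow hy
    rw [mem_singleton_iff]
    linarith
  have hmeas : MeasurableSet ((a + ·) '' B) := (hB.image (by fun_prop)).measurableSet
  calc volume A + volume B = volume ((· + b) '' A ∪ (a + ·) '' B) := by
        rw [measure_union₀ hmeas.nullMeasurableSet hdisj]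
        simp
    _ ≤ volume (A + B) := by
        refine measure_mono (union_subset ?_ ?_)
        · rintro _ ⟨x, hx, rfl⟩
          exact add_mem_add hx hb
        · rintro _ ⟨y, hy, rfl⟩
          exact add_mem_add ha hy

theorem volume_add_volume_le_two_mul {A B C : Set ℝ} (hA : MeasurableSet A)
    (hB : MeasurableSet B) (hA' : A.Nonempty) (hB' : B.Nonempty)
    (h : ∀ x ∈ A, ∀ y ∈ B, (x + y) / 2 ∈ C) : volume A + volume B ≤ 2 * volume C := by
  obtain ⟨a, ha⟩ := hA'
  obtain ⟨b, hb⟩ := hB'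
  rw [hA.measure_eq_iSup_isCompact, hB.measure_eq_iSup_isCompact]
  simp only [iSup_and']
  refine ENNReal.biSup_add_biSup_le' (p := fun K => K ⊆ A ∧ IsCompact K)
    (q := fun L => L ⊆ B ∧ IsCompact L) ⟨∅, by simp⟩ ⟨∅, by simp⟩ fun K hK L hL => ?_
  have hsub : insert a K + insert b L ⊆ (2 : ℝ) • C := by
    rintro _ ⟨x, hx, y, hy, rfl⟩
    exact ⟨_, h x (insert_subset ha hK.1 hx) y (insert_subset hb hL.1 hy), by simp; ring⟩
  calc volume K + volume L ≤ volume (insert a K) + volume (insert b L) := by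
        gcongr <;> exact subset_insert _ _
    _ ≤ volume (insert a K + insert b L) := volume_add_volume_le_volume_add
        (hK.2.insert a) (hL.2.insert b) (insert_nonempty _ _) (insert_nonempty _ _)
    _ ≤ volume ((2 : ℝ) • C) := measure_mono hsub
    _ = 2 * volume C := by rw [Measure.addHaar_smul]; simp

theorem lintegral_ofReal_eq_setLIntegral_Ioo_meas_lt {α : Type*} [MeasurableSpace α]
    (μ : Measure α) {f : α → ℝ} {M : ℝ} (hf : Measurable f) (hf0 : 0 ≤ f) (hM : 0 < M)
    (hfM : ∀ x, f x ≤ M) :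
    ∫⁻ x, ENNReal.ofReal (f x) ∂μ = ∫⁻ t in Ioo 0 M, μ {x | t < f x} := by
  rw [lintegral_eq_lintegral_meas_lt μ (ae_of_all _ hf0) hf.aemeasurable,
    ← Ioo_union_Ici_eq_Ioi hM, lintegral_union measurableSet_Ici
      (disjoint_left.2 fun _ ht ht' => ht.2.not_ge ht'),
    setLIntegral_eq_zero measurableSet_Ici, add_zero]
  intro t ht
  simp [((hfM _).trans ht).not_gt]

theorem measurable_meas_lt {α : Type*} [MeasurableSpace α] (μ : Measure α) (f : α → ℝ) :
    Measurable fun t : ℝ => μ {x | t < f x} :=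
  Antitone.measurable fun _ _ hst => measure_mono fun _ hx => hst.trans_lt hx

theorem lintegral_add_lintegral_le_two_mul {f g h : ℝ → ℝ} (hf : Measurable f) (hg : Measurable g)
    (hh : Measurable h) (hf0 : 0 ≤ f) (hg0 : 0 ≤ g) (hh0 : 0 ≤ h) (hfb : BddAbove (range f))
    (hgb : BddAbove (range g)) (hpos : 0 < ⨆ x, f x) (hsup : ⨆ x, f x = ⨆ x, g x)
    (H : ∀ x y, min (f x) (g y) ≤ h ((x + y) / 2)) :
    (∫⁻ x, ENNReal.ofReal (f x)) + (∫⁻ x, ENNReal.ofReal (g x)) ≤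
      2 * ∫⁻ x, ENNReal.ofReal (h x) := by
  set M := ⨆ x, f x
  have hlevel : ∀ t ∈ Ioo 0 M,
      volume {x | t < f x} + volume {x | t < g x} ≤ 2 * volume {x | t < h x} := fun t ht =>
    volume_add_volume_le_two_mul (measurableSet_lt measurable_const hf)
      (measurableSet_lt measurable_const hg) (exists_lt_of_lt_ciSup ht.2)
      (exists_lt_of_lt_ciSup (ht.2.trans_eq hsup)) fun x hx y hy => (lt_min hx hy).trans_le (H x y)
  calc (∫⁻ x, ENNReal.ofReal (f x)) + (∫⁻ x, ENNReal.ofReal (g x))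
      = ∫⁻ t in Ioo 0 M, (volume {x | t < f x} + volume {x | t < g x}) := by
        rw [lintegral_ofReal_eq_setLIntegral_Ioo_meas_lt _ hf hf0 hpos (le_ciSup hfb),
          lintegral_ofReal_eq_setLIntegral_Ioo_meas_lt _ hg hg0 hpos
            fun x => hsup ▸ le_ciSup hgb x,
          lintegral_add_left (measurable_meas_lt _ _)]
    _ ≤ ∫⁻ t in Ioo 0 M, 2 * volume {x | t < h x} := setLIntegral_mono' measurableSet_Ioo hlevel
    _ ≤ ∫⁻ t in Ioi 0, 2 * volume {x | t < h x} := by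
        gcongr
        exact Ioo_subset_Ioi_self
    _ = 2 * ∫⁻ x, ENNReal.ofReal (h x) := by
        rw [lintegral_const_mul _ (measurable_meas_lt _ _),
          ← lintegral_eq_lintegral_meas_lt _ (ae_of_all _ hh0) hh.aemeasurable]

theorem four_mul_le_add_sq (a b : ENNReal) : 4 * (a * b) ≤ (a + b) ^ 2 := by
  rcases eq_or_ne a ⊤ with rfl | ha
  · simp
  rcases eq_or_ne b ⊤ with rfl | hb
  · simp
  lift a to NNReal using ha
  lift b to NNReal using hb
  norm_cast
  simpa only [mul_assoc] using four_mul_le_sq_add a b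

theorem lintegral_ofReal_const_mul {α : Type*} [MeasurableSpace α] {μ : Measure α} {f : α → ℝ}
    (hf : Measurable f) {c : ℝ} (hc : 0 ≤ c) :
    ∫⁻ x, ENNReal.ofReal (c * f x) ∂μ = ENNReal.ofReal c * ∫⁻ x, ENNReal.ofReal (f x) ∂μ := by
  simp_rw [ENNReal.ofReal_mul hc]
  exact lintegral_const_mul _ hf.ennreal_ofReal

theorem min_le_of_mul_le_sq {a b c : ℝ} (ha : 0 ≤ a) (hb : 0 ≤ b) (hc : 0 ≤ c)
    (h : a * b ≤ c ^ 2) : min a b ≤ c := by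
  refine le_of_sq_le_sq (le_trans ?_ h) hc
  rw [sq]
  exact mul_le_mul (min_le_left a b) (min_le_right a b) (le_min ha hb) ha

theorem exists_iSup_mul_eq_iSup_inv_mul {ι κ : Sort*} {f : ι → ℝ} {g : κ → ℝ}
    (hf : 0 < ⨆ i, f i) (hg : 0 < ⨆ j, g j) :
    ∃ c > 0, ⨆ i, c * f i = ⨆ j, c⁻¹ * g j := by
  have hgf := div_pos hg hf
  have hc := Real.sqrt_pos.2 hgf
  refine ⟨√((⨆ j, g j) / ⨆ i, f i), hc, ?_⟩
  rw [← Real.mul_iSup_of_nonneg hc.le, ← Real.mul_iSup_of_nonneg (inv_pos.2 hc).le,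
    eq_inv_mul_iff_mul_eq₀ hc.ne', ← mul_assoc, Real.mul_self_sqrt hgf.le,
    div_mul_cancel₀ _ hf.ne']

/-- The Prékopa–Leindler inequality on the line, with equal weights. -/
theorem lintegral_mul_lintegral_le_sq {f g h : ℝ → ℝ} (hf : Measurable f) (hg : Measurable g)
    (hh : Measurable h) (hf0 : 0 ≤ f) (hg0 : 0 ≤ g) (hh0 : 0 ≤ h) (hfb : BddAbove (range f))
    (hgb : BddAbove (range g)) (H : ∀ x y, f x * g y ≤ h ((x + y) / 2) ^ 2) :
    (∫⁻ x, ENNReal.ofReal (f x)) * (∫⁻ x, ENNReal.ofReal (g x)) ≤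
      (∫⁻ x, ENNReal.ofReal (h x)) ^ 2 := by
  rcases (Real.iSup_nonneg hf0).eq_or_lt with hM | hM
  · have hf_le : ∀ x, f x ≤ 0 := fun x => (le_ciSup hfb x).trans_eq hM.symm
    simp [ENNReal.ofReal_of_nonpos, hf_le]
  rcases (Real.iSup_nonneg hg0).eq_or_lt with hN | hN
  · have hg_le : ∀ x, g x ≤ 0 := fun x => (le_ciSup hgb x).trans_eq hN.symm
    simp [ENNReal.ofReal_of_nonpos, hg_le]
  -- Rescaling `f` by `c` and `g` by `c⁻¹` equalizes their suprema and keeps the product.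
  obtain ⟨c, hc, hsup⟩ := exists_iSup_mul_eq_iSup_inv_mul hM hN
  have hcf : 0 ≤ fun x => c * f x := fun x => mul_nonneg hc.le (hf0 x)
  have hcg : 0 ≤ fun x => c⁻¹ * g x := fun x => mul_nonneg (inv_pos.2 hc).le (hg0 x)
  have hmin : ∀ x y, min (c * f x) (c⁻¹ * g y) ≤ h ((x + y) / 2) := fun x y =>
    min_le_of_mul_le_sq (hcf x) (hcg y) (hh0 _) <| by
      rw [mul_mul_mul_comm, mul_inv_cancel₀ hc.ne', one_mul]
      exact H x y
  have hsum := lintegral_add_lintegral_le_two_mul (hf.const_mul c) (hg.const_mul c⁻¹) hh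
    hcf hcg hh0 (hfb.range_comp_left (monotone_mul_left_of_nonneg hc.le))
    (hgb.range_comp_left (monotone_mul_left_of_nonneg (inv_pos.2 hc).le))
    (by rw [← Real.mul_iSup_of_nonneg hc.le]; positivity) hsup hmin
  rw [lintegral_ofReal_const_mul hf hc.le, lintegral_ofReal_const_mul hg (inv_pos.2 hc).le] at hsum
  set I := ∫⁻ x, ENNReal.ofReal (f x)
  set J := ∫⁻ x, ENNReal.ofReal (g x)
  set L := ∫⁻ x, ENNReal.ofReal (h x)
  have hcc : ENNReal.ofReal c * ENNReal.ofReal c⁻¹ = 1 := by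
    rw [← ENNReal.ofReal_mul hc.le, mul_inv_cancel₀ hc.ne', ENNReal.ofReal_one]
  refine (ENNReal.mul_le_mul_iff_right (by norm_num : (4 : ENNReal) ≠ 0) (by norm_num)).1 ?_
  calc 4 * (I * J) = 4 * (ENNReal.ofReal c * I * (ENNReal.ofReal c⁻¹ * J)) := by
        rw [mul_mul_mul_comm, hcc, one_mul]
    _ ≤ (ENNReal.ofReal c * I + ENNReal.ofReal c⁻¹ * J) ^ 2 := four_mul_le_add_sq _ _
    _ ≤ (2 * L) ^ 2 := pow_le_pow_left₀ (by simp) hsum 2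
    _ = 4 * L ^ 2 := by rw [mul_pow]; norm_num

theorem isCompact_prodMk_preimage {X Y : Type*} [TopologicalSpace X] [TopologicalSpace Y]
    [T1Space X] {K : Set (X × Y)} (hK : IsCompact K) (x : X) : IsCompact (Prod.mk x ⁻¹' K) :=
  Topology.IsClosedEmbedding.isCompact_preimage
    ⟨isEmbedding_prodMkRight x, isClosedMap_prodMk_left x |>.isClosed_range⟩ hK

/-- The volume of the slice of a subset of `ℝ × ℝⁿ` over a point of the first factor. -/
noncomputable def sliceVolume {n : ℕ} (K : Set (ℝ × (Fin n → ℝ))) (t : ℝ) : ℝ :=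
  volume.real (Prod.mk t ⁻¹' K)

section SliceVolume

variable {n : ℕ} {K : Set (ℝ × (Fin n → ℝ))}

theorem sliceVolume_nonneg (K : Set (ℝ × (Fin n → ℝ))) : 0 ≤ sliceVolume K :=
  fun _ => measureReal_nonneg

theorem ofReal_sliceVolume (hK : IsCompact K) (t : ℝ) :
    ENNReal.ofReal (sliceVolume K t) = volume (Prod.mk t ⁻¹' K) :=
  ofReal_measureReal (isCompact_prodMk_preimage hK t).measure_lt_top.ne

theorem measurable_sliceVolume (hK : IsCompact K) : Measurable (sliceVolume K) :=
  (measurable_measure_prodMk_left hK.measurableSet).ennreal_toReal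

theorem volume_eq_lintegral_sliceVolume (hK : IsCompact K) :
    volume K = ∫⁻ t, ENNReal.ofReal (sliceVolume K t) := by
  rw [Measure.volume_eq_prod, Measure.prod_apply hK.measurableSet]
  exact lintegral_congr fun t => (ofReal_sliceVolume hK t).symm

theorem bddAbove_range_sliceVolume (hK : IsCompact K) : BddAbove (range (sliceVolume K)) := by
  refine ⟨volume.real (Prod.snd '' K), ?_⟩
  rintro _ ⟨t, rfl⟩
  exact measureReal_mono (fun w hw => ⟨_, hw, rfl⟩)
    (hK.image continuous_snd).measure_lt_top.ne

theorem sliceVolume_neg (K : Set (ℝ × (Fin n → ℝ))) (t : ℝ) :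
    sliceVolume (-K) (-t) = sliceVolume K t := by
  have : Prod.mk (-t) ⁻¹' (-K) = -(Prod.mk t ⁻¹' K) := by
    ext w
    simp
  rw [sliceVolume, this, measureReal_def, Measure.measure_neg, ← measureReal_def, sliceVolume]

theorem sliceVolume_mul_sliceVolume_le_sq
    (hn : ∀ {A B : Set (Fin n → ℝ)}, IsCompact A → IsCompact B →
      volume A * volume B ≤ volume ((2⁻¹ : ℝ) • (A + B)) ^ 2)
    {A B : Set (ℝ × (Fin n → ℝ))} (hA : IsCompact A) (hB : IsCompact B) (x y : ℝ) :
    sliceVolume A x * sliceVolume B y ≤ sliceVolume ((2⁻¹ : ℝ) • (A + B)) ((x + y) / 2) ^ 2 := by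
  have hsub : (2⁻¹ : ℝ) • (Prod.mk x ⁻¹' A + Prod.mk y ⁻¹' B) ⊆
      Prod.mk ((x + y) / 2) ⁻¹' ((2⁻¹ : ℝ) • (A + B)) := by
    rintro _ ⟨_, ⟨v, hv, w, hw, rfl⟩, rfl⟩
    refine ⟨_, ⟨_, hv, _, hw, rfl⟩, ?_⟩
    ext
    · simp; ring
    · simp [mul_add]
  simp only [sliceVolume, measureReal_def, ← ENNReal.toReal_mul, ← ENNReal.toReal_pow]
  have hfin : volume (Prod.mk ((x + y) / 2) ⁻¹' ((2⁻¹ : ℝ) • (A + B))) ≠ ⊤ :=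
    (isCompact_prodMk_preimage ((hA.add hB).smul _) _).measure_lt_top.ne
  refine ENNReal.toReal_mono (ENNReal.pow_ne_top hfin) ?_
  calc _ ≤ volume ((2⁻¹ : ℝ) • (Prod.mk x ⁻¹' A + Prod.mk y ⁻¹' B)) ^ 2 :=
        hn (isCompact_prodMk_preimage hA x) (isCompact_prodMk_preimage hB y)
    _ ≤ _ := by gcongr

end SliceVolume

theorem volume_mul_volume_le_sq_of_isEmpty {ι : Type*} [Fintype ι] [IsEmpty ι]
    (A B : Set (ι → ℝ)) : volume A * volume B ≤ volume ((2⁻¹ : ℝ) • (A + B)) ^ 2 := by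
  rcases A.eq_empty_or_nonempty with rfl | hA
  · simp
  rcases B.eq_empty_or_nonempty with rfl | hB
  · simp
  rw [Subsingleton.eq_univ_of_nonempty hA, Subsingleton.eq_univ_of_nonempty hB,
    Subsingleton.eq_univ_of_nonempty ((univ_nonempty.add univ_nonempty).smul_set),
    volume_pi, Measure.pi_of_empty _ isEmptyElim]
  simp

theorem volume_mul_volume_le_sq (n : ℕ) : ∀ {A B : Set (Fin n → ℝ)}, IsCompact A → IsCompact B →
    volume A * volume B ≤ volume ((2⁻¹ : ℝ) • (A + B)) ^ 2 := by
  induction n with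
  | zero => exact fun _ _ => volume_mul_volume_le_sq_of_isEmpty _ _
  | succ n ih =>
    intro A B hA hB
    let e : (Fin (n + 1) → ℝ) ≃L[ℝ] ℝ × (Fin n → ℝ) := Fin.consEquivL ℝ (fun _ => ℝ) |>.symm
    have he : MeasurePreserving e := volume_preserving_piFinSuccAbove (fun _ => ℝ) 0
    have hvol : ∀ K, volume K = volume (e '' K) := fun K => by
      rw [← he.measure_preimage_emb e.toHomeomorph.measurableEmbedding,
        preimage_image_eq _ e.injective]
    have hmid : e '' ((2⁻¹ : ℝ) • (A + B)) = (2⁻¹ : ℝ) • (e '' A + e '' B) := by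
      rw [image_smul_comm _ _ _ (map_smul e _), image_add]
    have hA' := hA.image e.continuous
    have hB' := hB.image e.continuous
    have hC' : IsCompact ((2⁻¹ : ℝ) • (e '' A + e '' B)) := (hA'.add hB').smul _
    rw [hvol A, hvol B, hvol, hmid, volume_eq_lintegral_sliceVolume hA',
      volume_eq_lintegral_sliceVolume hB', volume_eq_lintegral_sliceVolume hC']
    exact lintegral_mul_lintegral_le_sq (measurable_sliceVolume hA') (measurable_sliceVolume hB')
      (measurable_sliceVolume hC') (sliceVolume_nonneg _) (sliceVolume_nonneg _)
      (sliceVolume_nonneg _) (bddAbove_range_sliceVolume hA') (bddAbove_range_sliceVolume hB')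
      (sliceVolume_mul_sliceVolume_le_sq ih hA' hB')

end BrunnMinkowski

section ReversingTransport

open MeasureTheory Set

variable {a b : ℝ} {F : ℝ → ℝ}

theorem exists_hasDerivAt_inverse {Φ F' : ℝ → ℝ} (hab : a ≤ b) (hΦ : ContinuousOn Φ (Icc a b))
    (hderiv : ∀ x ∈ Ioo a b, HasDerivAt Φ (F' x) x) (hpos : ∀ x ∈ Ioo a b, 0 < F' x) :
    ∃ τ : ℝ → ℝ, MapsTo τ (Ioo (Φ a) (Φ b)) (Ioo a b) ∧
      ∀ m ∈ Ioo (Φ a) (Φ b), HasDerivAt τ (F' (τ m))⁻¹ m := by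
  have hmono : StrictMonoOn Φ (Icc a b) :=
    strictMonoOn_of_deriv_pos (convex_Icc a b) hΦ fun x hx => by
      rw [interior_Icc] at hx
      exact (hderiv x hx).deriv ▸ hpos x hx
  choose! τ hτ hΦτ using intermediate_value_Ioo hab hΦ
  have hmaps : MapsTo Φ (Ioo a b) (Ioo (Φ a) (Φ b)) := fun x hx =>
    ⟨hmono (left_mem_Icc.2 hab) (Ioo_subset_Icc_self hx) hx.1,
      hmono (Ioo_subset_Icc_self hx) (right_mem_Icc.2 hab) hx.2⟩
  have hτmono : StrictMonoOn τ (Ioo (Φ a) (Φ b)) := fun m hm m' hm' hmm' =>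
    (hmono.lt_iff_lt (Ioo_subset_Icc_self (hτ hm)) (Ioo_subset_Icc_self (hτ hm'))).1 <| by
      rwa [hΦτ hm, hΦτ hm']
  have himage : τ '' Ioo (Φ a) (Φ b) = Ioo a b :=
    (MapsTo.image_subset hτ).antisymm fun x hx => ⟨Φ x, hmaps hx,
      hmono.injOn (Ioo_subset_Icc_self (hτ (hmaps hx))) (Ioo_subset_Icc_self hx) (hΦτ (hmaps hx))⟩
  refine ⟨τ, hτ, fun m hm => ?_⟩
  refine HasDerivAt.of_local_left_inverse ?_ (hderiv _ (hτ hm)) (hpos _ (hτ hm)).ne' ?_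
  · refine hτmono.continuousAt_of_image_mem_nhds (isOpen_Ioo.mem_nhds hm) ?_
    rw [himage]
    exact isOpen_Ioo.mem_nhds (hτ hm)
  · filter_upwards [isOpen_Ioo.mem_nhds hm] with y hy using hΦτ hy

/-- `ψ` sends `x` to the point with as much mass of `F` on its right as `x` has on its left. -/
theorem exists_reversing_transport (hab : a ≤ b) (hc : ContinuousOn F (Ioo a b))
    (hpos : ∀ x ∈ Ioo a b, 0 < F x) (hint : IntegrableOn F (Ioo a b)) :
    ∃ ψ : ℝ → ℝ, MapsTo ψ (Ioo a b) (Ioo a b) ∧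
      ∀ x ∈ Ioo a b, HasDerivAt ψ (-(F x / F (ψ x))) x := by
  have hII : IntervalIntegrable F volume a b :=
    (intervalIntegrable_iff_integrableOn_Ioo_of_le hab).2 hint
  set Φ : ℝ → ℝ := fun x => ∫ t in a..x, F t
  have hΦ : ContinuousOn Φ (Icc a b) := by
    simpa only [uIcc_of_le hab] using
      intervalIntegral.continuousOn_primitive_interval (μ := volume) (f := F) (a := a) (b := b)
        (by rwa [uIcc_of_le hab, integrableOn_Icc_iff_integrableOn_Ioo])
  have hderiv : ∀ x ∈ Ioo a b, HasDerivAt Φ (F x) x := fun x hx =>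
    intervalIntegral.integral_hasDerivAt_right
      (hII.mono_set (uIcc_subset_uIcc_left (uIcc_of_le hab ▸ Ioo_subset_Icc_self hx)))
      (hc.stronglyMeasurableAtFilter isOpen_Ioo x hx) (hc.continuousAt (isOpen_Ioo.mem_nhds hx))
  obtain ⟨τ, hτ, hτderiv⟩ := exists_hasDerivAt_inverse hab hΦ hderiv hpos
  have hreflect : ∀ x ∈ Ioo a b, Φ b - Φ x ∈ Ioo (Φ a) (Φ b) := fun x hx => by
    have hΦa : Φ a = 0 := intervalIntegral.integral_same
    have hmono := strictMonoOn_of_deriv_pos (convex_Icc a b) hΦ fun y hy => by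
      rw [interior_Icc] at hy
      exact (hderiv y hy).deriv ▸ hpos y hy
    have hax := hmono (left_mem_Icc.2 hab) (Ioo_subset_Icc_self hx) hx.1
    have hxb := hmono (Ioo_subset_Icc_self hx) (right_mem_Icc.2 hab) hx.2
    constructor <;> linarith
  refine ⟨fun x => τ (Φ b - Φ x), fun x hx => hτ (hreflect x hx), fun x hx => ?_⟩
  refine ((hτderiv _ (hreflect x hx)).comp x ((hderiv x hx).const_sub (Φ b))).congr_deriv ?_
  ring

theorem half_one_add_div_mul_sqrt_sub {p q : ℝ} (hp : 0 < p) (hq : 0 < q) :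
    (1 + p / q) / 2 * √(p * q) - p = √p / (2 * √q) * (√p - √q) ^ 2 := by
  obtain ⟨r, hr, rfl⟩ : ∃ r, 0 < r ∧ p = r ^ 2 :=
    ⟨√p, Real.sqrt_pos.2 hp, (Real.sq_sqrt hp.le).symm⟩
  obtain ⟨s, hs, rfl⟩ : ∃ s, 0 < s ∧ q = s ^ 2 :=
    ⟨√q, Real.sqrt_pos.2 hq, (Real.sq_sqrt hq.le).symm⟩
  rw [← mul_pow, Real.sqrt_sq (mul_pos hr hs).le, Real.sqrt_sq hr.le, Real.sqrt_sq hs.le]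
  field_simp
  ring

theorem le_half_one_add_div_mul_sqrt {p q : ℝ} (hp : 0 < p) (hq : 0 < q) :
    p ≤ (1 + p / q) / 2 * √(p * q) := by
  rw [← sub_nonneg, half_one_add_div_mul_sqrt_sub hp hq]
  positivity

theorem eq_of_eq_half_one_add_div_mul_sqrt {p q : ℝ} (hp : 0 < p) (hq : 0 < q)
    (h : p = (1 + p / q) / 2 * √(p * q)) : p = q := by
  have hgap := half_one_add_div_mul_sqrt_sub hp hq
  rw [← h, sub_self, eq_comm] at hgap
  have hfactor : √p / (2 * √q) ≠ 0 := by positivity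
  exact (Real.sqrt_inj hp.le hq.le).1
    (sub_eq_zero.1 (pow_eq_zero_iff two_ne_zero |>.1 ((mul_eq_zero.1 hgap).resolve_left hfactor)))

/-- Change of variables along `x ↦ (x - ψ x) / 2`. -/
theorem setLIntegral_transport_le {H ψ : ℝ → ℝ} (hpos : ∀ x ∈ Ioo a b, 0 < F x) (hH0 : 0 ≤ H)
    (hH : ∀ x ∈ Ioo a b, ∀ y ∈ Ioo a b, F x * F y ≤ H ((x - y) / 2) ^ 2)
    (hψ : MapsTo ψ (Ioo a b) (Ioo a b))
    (hderiv : ∀ x ∈ Ioo a b, HasDerivAt ψ (-(F x / F (ψ x))) x) :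
    ∫⁻ x in Ioo a b, ENNReal.ofReal ((1 + F x / F (ψ x)) / 2 * √(F x * F (ψ x))) ≤
      ∫⁻ x, ENNReal.ofReal (H x) := by
  set θ : ℝ → ℝ := fun x => (x - ψ x) / 2
  set θ' : ℝ → ℝ := fun x => (1 + F x / F (ψ x)) / 2
  have hθ : ∀ x ∈ Ioo a b, HasDerivAt θ (θ' x) x := fun x hx =>
    (((hasDerivAt_id x).sub (hderiv x hx)).div_const 2).congr_deriv (by rw [sub_neg_eq_add])
  have hθinj : InjOn θ (Ioo a b) := by
    refine (strictMonoOn_of_deriv_pos (convex_Ioo a b) ?_ ?_).injOn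
    · exact fun x hx => (hθ x hx).continuousAt.continuousWithinAt
    · rw [interior_Ioo]
      exact fun x hx => (hθ x hx).deriv ▸
        half_pos (add_pos one_pos (div_pos (hpos x hx) (hpos _ (hψ hx))))
  calc _ ≤ ∫⁻ x in Ioo a b, ENNReal.ofReal |θ' x| * ENNReal.ofReal (H (θ x)) := by
        refine setLIntegral_mono' measurableSet_Ioo fun x hx => ?_
        rw [← ENNReal.ofReal_mul (abs_nonneg _)]
        gcongr
        · exact le_abs_self _
        · exact Real.sqrt_le_iff.2 ⟨hH0 _, hH x hx _ (hψ hx)⟩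
    _ = ∫⁻ y in θ '' Ioo a b, ENNReal.ofReal (H y) :=
        (lintegral_image_eq_lintegral_abs_deriv_mul measurableSet_Ioo
          (fun x hx => (hθ x hx).hasDerivWithinAt) hθinj fun y => ENNReal.ofReal (H y)).symm
    _ ≤ ∫⁻ x, ENNReal.ofReal (H x) := setLIntegral_le_lintegral _ _

theorem eq_apply_transport_of_lintegral_le {ψ : ℝ → ℝ} (hc : ContinuousOn F (Ioo a b))
    (hpos : ∀ x ∈ Ioo a b, 0 < F x) (hint : IntegrableOn F (Ioo a b))
    (hψc : ContinuousOn ψ (Ioo a b)) (hψ : MapsTo ψ (Ioo a b) (Ioo a b))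
    (hle : ∫⁻ x in Ioo a b, ENNReal.ofReal ((1 + F x / F (ψ x)) / 2 * √(F x * F (ψ x))) ≤
      ∫⁻ x in Ioo a b, ENNReal.ofReal (F x)) :
    ∀ x ∈ Ioo a b, F x = F (ψ x) := by
  set G : ℝ → ℝ := fun x => (1 + F x / F (ψ x)) / 2 * √(F x * F (ψ x))
  have hFψ : ContinuousOn (F ∘ ψ) (Ioo a b) := hc.comp hψc hψ
  have hGc : ContinuousOn G (Ioo a b) :=
    ((continuousOn_const.add (hc.div hFψ fun x hx => (hpos _ (hψ hx)).ne')).div_const 2).mul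
      (hc.mul hFψ).sqrt
  have hFG : ∀ x ∈ Ioo a b, F x ≤ G x := fun x hx =>
    le_half_one_add_div_mul_sqrt (hpos x hx) (hpos _ (hψ hx))
  have hae : (fun x => ENNReal.ofReal (F x)) =ᵐ[volume.restrict (Ioo a b)]
      fun x => ENNReal.ofReal (G x) := by
    refine ae_eq_of_ae_le_of_lintegral_le ?_ hint.lintegral_lt_top.ne
      (hGc.aemeasurable measurableSet_Ioo).ennreal_ofReal hle
    filter_upwards [ae_restrict_mem measurableSet_Ioo] with x hx
    exact ENNReal.ofReal_le_ofReal (hFG x hx)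
  have heq : EqOn F G (Ioo a b) := by
    refine Measure.eqOn_open_of_ae_eq (μ := volume) ?_ isOpen_Ioo hc hGc
    filter_upwards [hae, ae_restrict_mem measurableSet_Ioo] with x hx hxI
    exact (ENNReal.ofReal_eq_ofReal_iff (hpos x hxI).le
      ((hpos x hxI).le.trans (hFG x hxI))).1 hx
  exact fun x hx => eq_of_eq_half_one_add_div_mul_sqrt (hpos x hx) (hpos _ (hψ hx)) (heq hx)

theorem eq_add_of_mapsTo_const_sub {c : ℝ} (hab : a < b)
    (h : MapsTo (fun x => c - x) (Ioo a b) (Ioo a b)) : c = a + b := by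
  have hIcc : MapsTo (fun x => c - x) (Icc a b) (Icc a b) := by
    simpa only [closure_Ioo hab.ne] using h.closure (by fun_prop)
  have hca := (hIcc (left_mem_Icc.2 hab.le)).2
  have hcb := (hIcc (right_mem_Icc.2 hab.le)).1
  linarith

theorem apply_add_sub_eq_of_lintegral_le {H : ℝ → ℝ} (hc : ContinuousOn F (Ioo a b))
    (hpos : ∀ x ∈ Ioo a b, 0 < F x) (hint : IntegrableOn F (Ioo a b)) (hH0 : 0 ≤ H)
    (hH : ∀ x ∈ Ioo a b, ∀ y ∈ Ioo a b, F x * F y ≤ H ((x - y) / 2) ^ 2)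
    (hle : ∫⁻ x, ENNReal.ofReal (H x) ≤ ∫⁻ x in Ioo a b, ENNReal.ofReal (F x)) :
    ∀ x ∈ Ioo a b, F (a + b - x) = F x := by
  intro x₀ hx₀
  have hab : a < b := hx₀.1.trans hx₀.2
  obtain ⟨ψ, hψ, hderiv⟩ := exists_reversing_transport hab.le hc hpos hint
  have hFψ := eq_apply_transport_of_lintegral_le hc hpos hint
    (fun x hx => (hderiv x hx).continuousAt.continuousWithinAt) hψ
    ((setLIntegral_transport_le hpos hH0 hH hψ hderiv).trans hle)
  have hconst : ∀ x ∈ Ioo a b, ψ x = x₀ + ψ x₀ - x := fun x hx => by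
    have hd : ∀ y ∈ Ioo a b, HasDerivAt (fun y => y + ψ y) 0 y := fun y hy =>
      ((hasDerivAt_id y).add (hderiv y hy)).congr_deriv <| by
        rw [← hFψ y hy, div_self (hpos y hy).ne', add_neg_cancel]
    have := isOpen_Ioo.is_const_of_deriv_eq_zero isPreconnected_Ioo
      (fun y hy => (hd y hy).differentiableAt.differentiableWithinAt)
      (fun y hy => (hd y hy).deriv) hx hx₀
    linarith
  have hsum : x₀ + ψ x₀ = a + b :=
    eq_add_of_mapsTo_const_sub hab fun x hx => by simpa only [← hconst x hx] using hψ hx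
  rw [← hsum, ← hconst x₀ hx₀, ← hFψ x₀ hx₀]

end ReversingTransport

section BrunnMinkowskiEquality

open MeasureTheory Set Filter Topology

variable {n : ℕ} {K : Set (ℝ × (Fin n → ℝ))} {a b : ℝ}

/-- The homothety with ratio `c` and center `(t, w)` maps `K` into itself. -/
theorem pow_mul_sliceVolume_le (hK : Convex ℝ K) (hc : IsCompact K) {x t c : ℝ} {w : Fin n → ℝ}
    (hw : (t, w) ∈ K) (h0 : 0 ≤ c) (h1 : c ≤ 1) :
    c ^ n * sliceVolume K x ≤ sliceVolume K (c * x + (1 - c) * t) := by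
  have hsub : (1 - c) • w +ᵥ c • (Prod.mk x ⁻¹' K) ⊆ Prod.mk (c * x + (1 - c) * t) ⁻¹' K := by
    rintro _ ⟨_, ⟨z, hz, rfl⟩, rfl⟩
    rw [mem_preimage]
    convert hK hz hw h0 (sub_nonneg.2 h1) (add_sub_cancel _ _) using 1
    ext <;> simp [add_comm]
  calc c ^ n * sliceVolume K x = volume.real ((1 - c) • w +ᵥ c • (Prod.mk x ⁻¹' K)) := by
        rw [measureReal_def, measure_vadd, Measure.addHaar_smul_of_nonneg _ h0, ENNReal.toReal_mul,
          ENNReal.toReal_ofReal (by positivity), Module.finrank_fin_fun]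
        rfl
    _ ≤ _ := measureReal_mono hsub (isCompact_prodMk_preimage hc _).measure_lt_top.ne

theorem min_pow_mul_sliceVolume_le (hK : Convex ℝ K) (hc : IsCompact K)
    (hfst : Prod.fst '' K = Icc a b) {x y : ℝ} (hx : x ∈ Ioo a b) (hy : y ∈ Ioo a b) :
    min ((b - y) / (b - x)) ((y - a) / (x - a)) ^ n * sliceVolume K x ≤ sliceVolume K y := by
  have hab : a ≤ b := hx.1.le.trans hx.2.le
  obtain ⟨wa, hwa⟩ : ∃ w, (a, w) ∈ K := by
    simpa using hfst.superset (left_mem_Icc.2 hab)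
  obtain ⟨wb, hwb⟩ : ∃ w, (b, w) ∈ K := by
    simpa using hfst.superset (right_mem_Icc.2 hab)
  have hbx := sub_pos.2 hx.2
  have hxa := sub_pos.2 hx.1
  have hby := sub_pos.2 hy.2
  have hya := sub_pos.2 hy.1
  rcases le_total x y with hxy | hyx
  · calc _ ≤ ((b - y) / (b - x)) ^ n * sliceVolume K x := by
          gcongr
          · exact sliceVolume_nonneg K x
          · exact min_le_left _ _
      _ ≤ sliceVolume K ((b - y) / (b - x) * x + (1 - (b - y) / (b - x)) * b) :=
          pow_mul_sliceVolume_le hK hc hwb (by positivity) ((div_le_one hbx).2 (by linarith))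
      _ = sliceVolume K y := by congr 1; field_simp; ring
  · calc _ ≤ ((y - a) / (x - a)) ^ n * sliceVolume K x := by
          gcongr
          · exact sliceVolume_nonneg K x
          · exact min_le_right _ _
      _ ≤ sliceVolume K ((y - a) / (x - a) * x + (1 - (y - a) / (x - a)) * a) :=
          pow_mul_sliceVolume_le hK hc hwa (by positivity) ((div_le_one hxa).2 (by linarith))
      _ = sliceVolume K y := by congr 1; field_simp; ring

theorem sliceVolume_eq_zero_of_notMem {s : Set ℝ} (hs : Prod.fst '' K ⊆ s) {t : ℝ}
    (ht : t ∉ s) : sliceVolume K t = 0 := by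
  have : Prod.mk t ⁻¹' K = ∅ := eq_empty_of_forall_notMem fun w hw => ht (hs ⟨_, hw, rfl⟩)
  rw [sliceVolume, this, measureReal_empty]

theorem volume_eq_setLIntegral_sliceVolume (hc : IsCompact K)
    (hfst : Prod.fst '' K ⊆ Icc a b) :
    volume K = ∫⁻ t in Ioo a b, ENNReal.ofReal (sliceVolume K t) := by
  rw [volume_eq_lintegral_sliceVolume hc, setLIntegral_congr Ioo_ae_eq_Icc,
    setLIntegral_eq_of_support_subset]
  intro t ht
  by_contra hnot
  exact ht (by simp [sliceVolume_eq_zero_of_notMem hfst hnot])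

theorem sliceVolume_pos (hK : Convex ℝ K) (hc : IsCompact K) (hfst : Prod.fst '' K = Icc a b)
    (hvol : volume K ≠ 0) {x : ℝ} (hx : x ∈ Ioo a b) : 0 < sliceVolume K x := by
  obtain ⟨y, hy, hFy⟩ : ∃ y ∈ Ioo a b, sliceVolume K y ≠ 0 := by
    by_contra! hzero
    refine hvol ?_
    rw [volume_eq_setLIntegral_sliceVolume hc hfst.subset, setLIntegral_eq_zero measurableSet_Ioo]
    intro t ht
    simp [hzero t ht]
  refine lt_of_lt_of_le (mul_pos (pow_pos (lt_min ?_ ?_) n)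
    ((sliceVolume_nonneg K y).lt_of_ne' hFy)) (min_pow_mul_sliceVolume_le hK hc hfst hy hx)
  · exact div_pos (sub_pos.2 hx.2) (sub_pos.2 hy.2)
  · exact div_pos (sub_pos.2 hx.1) (sub_pos.2 hy.1)

theorem continuousOn_sliceVolume (hK : Convex ℝ K) (hc : IsCompact K)
    (hfst : Prod.fst '' K = Icc a b) : ContinuousOn (sliceVolume K) (Ioo a b) := by
  intro x hx
  have hnear : ∀ᶠ y in 𝓝 x, y ∈ Ioo a b := isOpen_Ioo.mem_nhds hx
  have hbx : b - x ≠ 0 := (sub_pos.2 hx.2).ne'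
  have hxa : x - a ≠ 0 := (sub_pos.2 hx.1).ne'
  have hlower : Tendsto
      (fun y => min ((b - y) / (b - x)) ((y - a) / (x - a)) ^ n * sliceVolume K x)
      (𝓝 x) (𝓝 (sliceVolume K x)) := by
    have hcont : Continuous
        fun y => min ((b - y) / (b - x)) ((y - a) / (x - a)) ^ n * sliceVolume K x := by fun_prop
    simpa [div_self hbx, div_self hxa] using hcont.tendsto x
  have hupper : Tendsto
      (fun y => sliceVolume K x / min ((b - x) / (b - y)) ((x - a) / (y - a)) ^ n)
      (𝓝 x) (𝓝 (sliceVolume K x)) := by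
    have hcont : ContinuousAt (fun y => min ((b - x) / (b - y)) ((x - a) / (y - a)) ^ n) x := by
      fun_prop (disch := assumption)
    have hdiv : ContinuousAt
        (fun y => sliceVolume K x / min ((b - x) / (b - y)) ((x - a) / (y - a)) ^ n) x :=
      continuousAt_const.div hcont (by simp [div_self hbx, div_self hxa])
    simpa [div_self hbx, div_self hxa] using hdiv.tendsto
  refine (tendsto_of_tendsto_of_tendsto_of_le_of_le' hlower hupper ?_ ?_).mono_left
    nhdsWithin_le_nhds
  · filter_upwards [hnear] with y hy using min_pow_mul_sliceVolume_le hK hc hfst hx hy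
  · filter_upwards [hnear] with y hy
    rw [le_div_iff₀ (pow_pos (lt_min (div_pos (sub_pos.2 hx.2) (sub_pos.2 hy.2))
      (div_pos (sub_pos.2 hx.1) (sub_pos.2 hy.1))) n), mul_comm]
    exact min_pow_mul_sliceVolume_le hK hc hfst hy hx

theorem setIntegral_fst_eq_setIntegral_sliceVolume (hc : IsCompact K)
    (hfst : Prod.fst '' K ⊆ Icc a b) {g : ℝ → ℝ} (hg : Continuous g) :
    ∫ p in K, g p.1 = ∫ t in Ioo a b, g t * sliceVolume K t := by
  have hint : Integrable (K.indicator fun p => g p.1) (volume.prod volume) := by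
    rw [integrable_indicator_iff hc.measurableSet, ← Measure.volume_eq_prod]
    exact (hg.comp continuous_fst).continuousOn.integrableOn_compact hc
  rw [← integral_indicator hc.measurableSet, Measure.volume_eq_prod, integral_prod _ hint,
    setIntegral_congr_set Ioo_ae_eq_Icc, setIntegral_eq_integral_of_forall_compl_eq_zero
      fun t ht => by rw [sliceVolume_eq_zero_of_notMem hfst ht, mul_zero]]
  refine integral_congr_ae (ae_of_all _ fun t => ?_)
  have hslice : (fun w => K.indicator (fun p => g p.1) (t, w)) =
      (Prod.mk t ⁻¹' K).indicator fun _ => g t := rfl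
  simp only [hslice]
  rw [integral_indicator (isCompact_prodMk_preimage hc t).measurableSet, setIntegral_const,
    smul_eq_mul, mul_comm, sliceVolume]

theorem setIntegral_Ioo_eq_zero_of_odd {g : ℝ → ℝ} (hg : ∀ t ∈ Ioo a b, g (a + b - t) = -g t) :
    ∫ t in Ioo a b, g t = 0 := by
  rcases le_or_gt b a with hba | hab
  · rw [Ioo_eq_empty hba.not_gt, Measure.restrict_empty, integral_zero_measure]
  have hflip : ∫ t in a..b, g (a + b - t) = ∫ t in a..b, g t := by
    simp only [intervalIntegral.integral_comp_sub_left, add_sub_cancel_left, add_sub_cancel_right]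
  simp only [intervalIntegral.integral_of_le hab.le, integral_Ioc_eq_integral_Ioo] at hflip
  rw [setIntegral_congr_fun measurableSet_Ioo hg, integral_neg] at hflip
  linarith

theorem sliceVolume_add_sub_eq_of_volume_le (hK : Convex ℝ K) (hc : IsCompact K)
    (hvol : volume K ≠ 0) (hfst : Prod.fst '' K = Icc a b)
    (hle : volume ((2⁻¹ : ℝ) • (K + -K)) ≤ volume K) :
    ∀ t ∈ Ioo a b, sliceVolume K (a + b - t) = sliceVolume K t := by
  have hmass := volume_eq_setLIntegral_sliceVolume hc hfst.subset
  have hint : IntegrableOn (sliceVolume K) (Ioo a b) := by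
    refine ⟨(measurable_sliceVolume hc).aestronglyMeasurable, ?_⟩
    rw [hasFiniteIntegral_iff_ofReal (ae_of_all _ (sliceVolume_nonneg K)), ← hmass]
    exact hc.measure_lt_top
  refine apply_add_sub_eq_of_lintegral_le (H := sliceVolume ((2⁻¹ : ℝ) • (K + -K)))
    (continuousOn_sliceVolume hK hc hfst) (fun x hx => sliceVolume_pos hK hc hfst hvol hx) hint
    (sliceVolume_nonneg _) (fun x _ y _ => ?_) ?_
  · rw [← sliceVolume_neg K y]
    exact sliceVolume_mul_sliceVolume_le_sq (volume_mul_volume_le_sq n) hc hc.neg x (-y)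
  · rwa [← hmass, ← volume_eq_lintegral_sliceVolume ((hc.add hc.neg).smul _)]

theorem setIntegral_fst_eq_of_volume_le (hK : Convex ℝ K) (hc : IsCompact K)
    (hvol : volume K ≠ 0) (hle : volume ((2⁻¹ : ℝ) • (K + -K)) ≤ volume K) :
    ∫ p in K, p.1 = (sInf (Prod.fst '' K) + sSup (Prod.fst '' K)) / 2 * volume.real K := by
  have hne : K.Nonempty := nonempty_of_measure_ne_zero hvol
  have hfst := eq_Icc_of_connected_compact
    ⟨hne.image _, hK.isPreconnected.image _ continuous_fst.continuousOn⟩ (hc.image continuous_fst)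
  set a := sInf (Prod.fst '' K)
  set b := sSup (Prod.fst '' K)
  have hodd : ∫ t in Ioo a b, (t - (a + b) / 2) * sliceVolume K t = 0 :=
    setIntegral_Ioo_eq_zero_of_odd fun t ht => by
      rw [sliceVolume_add_sub_eq_of_volume_le hK hc hvol hfst hle t ht]
      ring
  rw [← setIntegral_fst_eq_setIntegral_sliceVolume hc hfst.subset (by fun_prop), integral_sub
    (continuous_fst.continuousOn.integrableOn_compact hc)
    (continuousOn_const.integrableOn_compact hc), setIntegral_const, smul_eq_mul] at hodd
  linarith

end BrunnMinkowskiEquality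

section Minkowski

open MeasureTheory Set

variable {E : Type*} [NormedAddCommGroup E] [NormedSpace ℝ E]

theorem exists_map_eq_smul_of_isAddHaarMeasure [MeasurableSpace E] [BorelSpace E]
    {μ : Measure E} [μ.IsAddHaarMeasure] {F : Type*} [NormedAddCommGroup F]
    [NormedSpace ℝ F] [FiniteDimensional ℝ F] [MeasurableSpace F] [BorelSpace F] (ν : Measure F)
    [ν.IsAddHaarMeasure] (Φ : E ≃L[ℝ] F) : ∃ c : ENNReal, c ≠ 0 ∧ c ≠ ⊤ ∧ μ.map Φ = c • ν := by
  have := Φ.isAddHaarMeasure_map μ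
  refine ⟨(Measure.addHaarScalarFactor (μ.map Φ) ν : ENNReal), ?_, by simp,
    Measure.isAddLeftInvariant_eq_smul _ _⟩
  simpa using (Measure.addHaarScalarFactor_pos_of_isAddHaarMeasure (μ.map Φ) ν).ne'

variable [FiniteDimensional ℝ E]

theorem exists_continuousLinearEquiv_fst_eq {u : StrongDual ℝ E} (hu : u ≠ 0) :
    ∃ (n : ℕ) (Φ : E ≃L[ℝ] ℝ × (Fin n → ℝ)), ∀ x, (Φ x).1 = u x := by
  obtain ⟨v, hv⟩ : ∃ v, u v = 1 := by
    obtain ⟨w, hw⟩ := DFunLike.ne_iff.1 hu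
    exact ⟨(u w)⁻¹ • w, by rw [map_smul, smul_eq_mul, inv_mul_cancel₀ (by simpa using hw)]⟩
  let splitting : E ≃L[ℝ] ℝ × u.ker := ContinuousLinearEquiv.equivOfRightInverse u
    (ContinuousLinearMap.toSpanSingleton ℝ v) fun t => by simp [hv]
  let coordinates : u.ker ≃L[ℝ] (Fin (Module.finrank ℝ u.ker) → ℝ) :=
    ContinuousLinearEquiv.ofFinrankEq (by simp)
  exact ⟨_, splitting.trans ((ContinuousLinearEquiv.refl ℝ ℝ).prodCongr coordinates),
    fun _ => rfl⟩

variable [MeasurableSpace E] [BorelSpace E] {μ : Measure E} [μ.IsAddHaarMeasure] {K : Set E}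

theorem setIntegral_apply_eq_of_measure_le (hK : Convex ℝ K) (hc : IsCompact K) (hμK : μ K ≠ 0)
    (hle : μ ((2⁻¹ : ℝ) • (K + -K)) ≤ μ K) {u : StrongDual ℝ E} (hu : u ≠ 0) :
    ∫ x in K, u x ∂μ = (sInf (u '' K) + sSup (u '' K)) / 2 * μ.real K := by
  obtain ⟨n, Φ, hΦ⟩ := exists_continuousLinearEquiv_fst_eq hu
  have : (volume : Measure (ℝ × (Fin n → ℝ))).IsAddHaarMeasure :=
    inferInstanceAs ((volume : Measure ℝ).prod volume).IsAddHaarMeasure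
  obtain ⟨c, hc0, hctop, hmap⟩ := exists_map_eq_smul_of_isAddHaarMeasure (μ := μ) volume Φ
  have hΦme : MeasurableEmbedding Φ := Φ.toHomeomorph.measurableEmbedding
  have hμ (A : Set E) : μ A = c * volume (Φ '' A) := by
    rw [← preimage_image_eq A Φ.injective, ← hΦme.map_apply, hmap, preimage_image_eq A Φ.injective]
    rfl
  have himage : Φ '' ((2⁻¹ : ℝ) • (K + -K)) = (2⁻¹ : ℝ) • (Φ '' K + -(Φ '' K)) := by
    rw [image_smul_set, image_add, image_neg]
  have hle' : volume ((2⁻¹ : ℝ) • (Φ '' K + -(Φ '' K))) ≤ volume (Φ '' K) := by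
    rwa [hμ, hμ K, himage, ENNReal.mul_le_mul_iff_right hc0 hctop] at hle
  have hΦK : Convex ℝ (Φ '' K) := hK.linear_image Φ.toLinearMap
  have hcentroid := setIntegral_fst_eq_of_volume_le hΦK (hc.image Φ.continuous)
    (right_ne_zero_of_mul (hμ K ▸ hμK)) hle'
  have hint : ∫ x in K, u x ∂μ = c.toReal * ∫ p in Φ '' K, p.1 := by
    rw [← smul_eq_mul, ← integral_smul_measure, ← Measure.restrict_smul, ← hmap,
      hΦme.setIntegral_map, preimage_image_eq K Φ.injective]
    simp only [hΦ]
  have hfst : Prod.fst '' (Φ '' K) = u '' K := by simp only [image_image, hΦ]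
  rw [hint, hcentroid, hfst, measureReal_def, measureReal_def, hμ K, ENNReal.toReal_mul]
  ring

/-- By the equality case of the Brunn–Minkowski inequality, the centroid of `K` is halfway between
any two parallel supporting hyperplanes; a Hahn–Banach separation then shows that `K` is symmetric
about it. -/
theorem exists_center_of_measure_le (hK : Convex ℝ K) (hc : IsCompact K) (hμK : μ K ≠ 0)
    (hle : μ ((2⁻¹ : ℝ) • (K + -K)) ≤ μ K) : ∃ c, ∀ x ∈ K, c - x ∈ K := by
  have hpos : 0 < μ.real K := ENNReal.toReal_pos hμK hc.measure_lt_top.ne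
  refine ⟨(2 * (μ.real K)⁻¹) • ∫ x in K, x ∂μ, fun x hx => ?_⟩
  by_contra hcon
  obtain ⟨u, s, hKs, hs⟩ := geometric_hahn_banach_closed_point hK hc.isClosed hcon
  have hu : u ≠ 0 := by
    rintro rfl
    exact lt_asymm (hKs x hx) hs
  have hcentroid : u (∫ x in K, x ∂μ) = (sInf (u '' K) + sSup (u '' K)) / 2 * μ.real K := by
    rw [← setIntegral_apply_eq_of_measure_le hK hc hμK hle hu]
    exact (u.integral_comp_comm (continuous_id.continuousOn.integrableOn_compact hc)).symm
  have hinf : sInf (u '' K) ≤ u x := csInf_le (hc.image u.continuous).bddBelow ⟨x, hx, rfl⟩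
  have hsup : sSup (u '' K) ≤ s :=
    csSup_le ⟨_, x, hx, rfl⟩ (forall_mem_image.2 fun y hy => (hKs y hy).le)
  have hmid : 2 * (μ.real K)⁻¹ * ((sInf (u '' K) + sSup (u '' K)) / 2 * μ.real K) =
      sInf (u '' K) + sSup (u '' K) := by
    field_simp
  rw [map_sub, map_smul, hcentroid, smul_eq_mul, hmid] at hs
  linarith

end Minkowski

section Faces

open Set Filter Topology

variable {V : Type*} [NormedAddCommGroup V] [InnerProductSpace ℝ V] {C F G : Set V}
  {m l x y : V}

/-- The face of `C` in the direction `m`: the set of points of `C` at which `⟪m, ·⟫` is maximal.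
It is `C` itself for `m = 0`. -/
def dirFace (C : Set V) (m : V) : Set V := {x ∈ C | ∀ y ∈ C, inner ℝ m y ≤ inner ℝ m x}

theorem dirFace_subset (C : Set V) (m : V) : dirFace C m ⊆ C := fun _ hx => hx.1

theorem dirFace_zero (C : Set V) : dirFace C 0 = C := by simp [dirFace]

theorem inner_eq_of_mem_dirFace (hx : x ∈ dirFace C m) (hy : y ∈ dirFace C m) :
    inner ℝ m x = inner ℝ m y :=
  le_antisymm (hy.2 x hx.1) (hx.2 y hy.1)

theorem mem_dirFace_iff (hx : x ∈ dirFace C m) :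
    y ∈ dirFace C m ↔ y ∈ C ∧ inner ℝ m y = inner ℝ m x :=
  ⟨fun hy => ⟨hy.1, inner_eq_of_mem_dirFace hy hx⟩, fun hy => ⟨hy.1, fun z hz => hy.2 ▸ hx.2 z hz⟩⟩

theorem mem_dirFace_of_le (hx : x ∈ dirFace C m) (hy : y ∈ C) (h : inner ℝ m x ≤ inner ℝ m y) :
    y ∈ dirFace C m :=
  ⟨hy, fun z hz => (hx.2 z hz).trans h⟩

theorem inner_lt_of_notMem_dirFace (hx : x ∈ dirFace C m) (hy : y ∈ C) (h : y ∉ dirFace C m) :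
    inner ℝ m y < inner ℝ m x :=
  lt_of_not_ge fun h' => h (mem_dirFace_of_le hx hy h')

theorem convex_dirFace (hC : Convex ℝ C) (m : V) : Convex ℝ (dirFace C m) := by
  intro x hx y hy a b ha hb hab
  refine ⟨hC hx.1 hy.1 ha hb hab, fun z hz => ?_⟩
  rw [inner_add_right, inner_smul_right, inner_smul_right, inner_eq_of_mem_dirFace hy hx,
    ← add_mul, hab, one_mul]
  exact hx.2 z hz

theorem dirFace_vadd (C : Set V) (m t : V) : dirFace (t +ᵥ C) m = t +ᵥ dirFace C m := by
  ext x
  simp only [dirFace, mem_vadd_set_iff_neg_vadd_mem, mem_ofPred_eq]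
  refine and_congr_right fun _ => ⟨fun h y hy => ?_, fun h y hy => ?_⟩
  · simpa [inner_add_right] using h (t + y) (by simpa using hy)
  · simpa [inner_add_right] using h _ hy

theorem dirFace_smul (C : Set V) (m : V) {a : ℝ} (ha : 0 < a) :
    dirFace C (a • m) = dirFace C m := by
  simp only [dirFace, real_inner_smul_left, mul_le_mul_iff_right₀ ha]

theorem dirFace_add_eq_inter (hne : (dirFace C m ∩ dirFace C l).Nonempty) :
    dirFace C (m + l) = dirFace C m ∩ dirFace C l := by
  obtain ⟨x, hxm, hxl⟩ := hne
  have hx : x ∈ dirFace C (m + l) := ⟨hxm.1, fun z hz => by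
    simpa only [inner_add_left] using add_le_add (hxm.2 z hz) (hxl.2 z hz)⟩
  ext y
  simp only [mem_inter_iff, mem_dirFace_iff hx, mem_dirFace_iff hxm, mem_dirFace_iff hxl,
    inner_add_left]
  constructor
  · rintro ⟨hy, hsum⟩
    have hym := hxm.2 y hy
    have hyl := hxl.2 y hy
    exact ⟨⟨hy, by linarith⟩, hy, by linarith⟩
  · rintro ⟨⟨hy, hym⟩, -, hyl⟩
    exact ⟨hy, by rw [hym, hyl]⟩

theorem dirFace_inter_dirFace_smul_add {c : ℝ}
    (hne : (dirFace C m ∩ dirFace C (c • m + l)).Nonempty) :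
    dirFace C m ∩ dirFace C (c • m + l) = dirFace (dirFace C m) l := by
  obtain ⟨x, hxm, hxl⟩ := hne
  have hshift {y : V} (hy : y ∈ dirFace C m) :
      inner ℝ (c • m + l) y = c * inner ℝ m x + inner ℝ l y := by
    rw [inner_add_left, real_inner_smul_left, inner_eq_of_mem_dirFace hy hxm]
  have hx : x ∈ dirFace (dirFace C m) l := ⟨hxm, fun y hy => by
    simpa only [hshift hy, hshift hxm, add_le_add_iff_left] using hxl.2 y hy.1⟩
  ext y
  rw [mem_inter_iff, mem_dirFace_iff hxl, mem_dirFace_iff hx]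
  refine and_congr_right fun hy => ?_
  rw [hshift hy, hshift hxm, add_right_inj, and_iff_right hy.1]

theorem mem_orthogonal_vectorSpan_iff :
    m ∈ (vectorSpan ℝ F)ᗮ ↔ ∀ x ∈ F, ∀ y ∈ F, inner ℝ m x = inner ℝ m y := by
  have hle : m ∈ (vectorSpan ℝ F)ᗮ ↔ vectorSpan ℝ F ≤ (ℝ ∙ m)ᗮ := by
    simp only [SetLike.le_def, Submodule.mem_orthogonal_singleton_iff_inner_right]
    exact Submodule.mem_orthogonal' _ _
  rw [hle, vectorSpan_def, Submodule.span_le, vsub_subset_iff]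
  simp only [SetLike.mem_coe, Submodule.mem_orthogonal_singleton_iff_inner_right, vsub_eq_sub,
    inner_sub_right, sub_eq_zero]

theorem mem_orthogonal_vectorSpan_dirFace (C : Set V) (m : V) :
    m ∈ (vectorSpan ℝ (dirFace C m))ᗮ :=
  mem_orthogonal_vectorSpan_iff.2 fun _ hx _ hy => inner_eq_of_mem_dirFace hx hy

theorem inner_sub_eq_zero_of_mem_orthogonal (hm : m ∈ (vectorSpan ℝ F)ᗮ) (hx : x ∈ F)
    (hy : y ∈ F) : inner ℝ m (x - y) = 0 :=
  (Submodule.mem_orthogonal' _ _).1 hm _ (vsub_mem_vectorSpan ℝ hx hy)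

theorem notMem_interior_of_mem_dirFace (hm : m ≠ 0) (hx : x ∈ dirFace C m) :
    x ∉ interior C := by
  intro hxi
  have hmax : IsLocalMax (innerSL ℝ m) x := by
    filter_upwards [mem_interior_iff_mem_nhds.1 hxi] with y hy using hx.2 y hy
  have hzero : innerSL ℝ m = 0 := hmax.hasFDerivAt_eq_zero (innerSL ℝ m).hasFDerivAt
  exact hm (inner_self_eq_zero.1 (DFunLike.congr_fun hzero m))

theorem eventually_add_mem_of_mem_intrinsicInterior (hx : x ∈ intrinsicInterior ℝ F) :
    ∀ᶠ g in 𝓝[(vectorSpan ℝ F : Set V)] 0, x + g ∈ F := by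
  obtain ⟨y, hy, rfl⟩ := hx
  have hF : ∀ᶠ z in 𝓝[(affineSpan ℝ F : Set V)] (y : V), z ∈ F := by
    rw [nhdsWithin_eq_map_subtype_coe y.2]
    exact mem_interior_iff_mem_nhds.1 hy
  have hadd : Tendsto (fun g => (y : V) + g) (𝓝[(vectorSpan ℝ F : Set V)] 0)
      (𝓝[(affineSpan ℝ F : Set V)] (y : V)) := by
    refine tendsto_nhdsWithin_iff.2 ⟨?_, ?_⟩
    · exact (Continuous.tendsto' (by fun_prop) _ _ (add_zero _)).mono_left nhdsWithin_le_nhds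
    · filter_upwards [self_mem_nhdsWithin] with g hg
      rw [add_comm]
      exact AffineSubspace.vadd_mem_of_mem_direction (by rwa [direction_affineSpan]) y.2
  exact hadd.eventually hF

theorem inner_eq_of_mem_intrinsicInterior (hx : x ∈ intrinsicInterior ℝ F)
    (hmax : ∀ z ∈ F, inner ℝ m z ≤ inner ℝ m x) (hy : y ∈ F) : inner ℝ m y = inner ℝ m x := by
  refine le_antisymm (hmax y hy) ?_
  have hline : Tendsto (fun t : ℝ => t • (x - y)) (𝓝[>] 0) (𝓝[(vectorSpan ℝ F : Set V)] 0) := by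
    refine tendsto_nhdsWithin_iff.2 ⟨?_, Eventually.of_forall fun t => ?_⟩
    · exact (Continuous.tendsto' (by fun_prop) 0 _ (zero_smul ℝ (x - y))).mono_left
        nhdsWithin_le_nhds
    · exact Submodule.smul_mem _ _ (vsub_mem_vectorSpan ℝ (intrinsicInterior_subset hx) hy)
  obtain ⟨t, htF, ht : 0 < t⟩ := ((hline.eventually
    (eventually_add_mem_of_mem_intrinsicInterior hx)).and self_mem_nhdsWithin).exists
  have hle := hmax _ htF
  rw [inner_add_right, inner_smul_right, inner_sub_right] at hle
  nlinarith

theorem subset_dirFace_of_mem_intrinsicInterior (hx : x ∈ intrinsicInterior ℝ F) (hF : F ⊆ C)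
    (hxm : x ∈ dirFace C m) : F ⊆ dirFace C m := fun _ hy =>
  mem_dirFace_of_le hxm (hF hy)
    (inner_eq_of_mem_intrinsicInterior hx (fun z hz => hxm.2 z (hF hz)) hy).ge

theorem inner_le_of_mem_convexHull {W : Set V} {c : ℝ} (h : ∀ w ∈ W, inner ℝ m w ≤ c)
    (hx : x ∈ convexHull ℝ W) : inner ℝ m x ≤ c :=
  convexHull_min (t := {x | inner ℝ m x ≤ c}) h
    (convex_halfSpace_le (innerₛₗ ℝ m).isLinear c) hx

theorem exists_mem_notMem_dirFace_convexHull {W : Set V}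
    (hne : ¬convexHull ℝ W ⊆ dirFace (convexHull ℝ W) m) :
    ∃ w ∈ W, w ∉ dirFace (convexHull ℝ W) m := by
  by_contra! hcon
  exact hne (convexHull_min hcon (convex_dirFace (convex_convexHull ℝ W) m))

/-- The supporting hyperplane of `dirFace C m` is tilted about `dirFace (dirFace C m) l` until it
hits a vertex `w` outside `dirFace C m`. -/
theorem exists_tilted_mem_dirFace {W : Set V} (hW : W.Finite)
    (hne : ¬convexHull ℝ W ⊆ dirFace (convexHull ℝ W) m)
    (hx : x ∈ dirFace (dirFace (convexHull ℝ W) m) l) :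
    ∃ c : ℝ, x ∈ dirFace (convexHull ℝ W) (c • m + l) ∧
      ∃ w ∈ dirFace (convexHull ℝ W) (c • m + l), w ∉ dirFace (convexHull ℝ W) m := by
  set C := convexHull ℝ W
  obtain ⟨w, ⟨hw, hwm⟩, hmax⟩ := exists_max_image {w ∈ W | w ∉ dirFace C m}
    (fun w => (inner ℝ l w - inner ℝ l x) / (inner ℝ m x - inner ℝ m w))
    (hW.subset (sep_subset _ _)) (exists_mem_notMem_dirFace_convexHull hne)
  set c := (inner ℝ l w - inner ℝ l x) / (inner ℝ m x - inner ℝ m w)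
  have hwC : w ∈ C := subset_convexHull ℝ W hw
  have hwx := inner_lt_of_notMem_dirFace hx.1 hwC hwm
  have hvertex (v : V) (hv : v ∈ W) : inner ℝ (c • m + l) v ≤ inner ℝ (c • m + l) x := by
    simp only [inner_add_left, real_inner_smul_left]
    by_cases hvm : v ∈ dirFace C m
    · rw [inner_eq_of_mem_dirFace hvm hx.1]
      linarith [hx.2 v hvm]
    · have hvx := inner_lt_of_notMem_dirFace hx.1 (subset_convexHull ℝ W hv) hvm
      have hslope := hmax v ⟨hv, hvm⟩
      rw [div_le_iff₀ (by linarith)] at hslope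
      linarith
  have hxc : x ∈ dirFace C (c • m + l) := ⟨hx.1.1, fun y => inner_le_of_mem_convexHull hvertex⟩
  refine ⟨c, hxc, w, mem_dirFace_of_le hxc hwC ?_, hwm⟩
  have hc : c * (inner ℝ m x - inner ℝ m w) = inner ℝ l w - inner ℝ l x :=
    div_mul_cancel₀ _ (by linarith)
  simp only [inner_add_left, real_inner_smul_left]
  linarith

theorem exists_dirFace_dirFace_eq {W : Set V} (hW : W.Finite)
    (hne : (dirFace (dirFace (convexHull ℝ W) m) l).Nonempty) :
    ∃ m', dirFace (dirFace (convexHull ℝ W) m) l = dirFace (convexHull ℝ W) m' := by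
  by_cases hm : convexHull ℝ W ⊆ dirFace (convexHull ℝ W) m
  · exact ⟨l, by rw [(dirFace_subset _ _).antisymm hm]⟩
  obtain ⟨x, hx⟩ := hne
  obtain ⟨c, hxc, -⟩ := exists_tilted_mem_dirFace hW hm hx
  exact ⟨m + (c • m + l), by
    rw [dirFace_add_eq_inter ⟨x, hx.1, hxc⟩, dirFace_inter_dirFace_smul_add ⟨x, hx.1, hxc⟩]⟩

theorem vectorSpan_eq_top_of_interior_nonempty (h : (interior C).Nonempty) :
    vectorSpan ℝ C = ⊤ := by
  rw [← direction_affineSpan, affineSpan_eq_top_of_nonempty_interior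
    (h.mono (interior_mono (subset_convexHull ℝ C))), AffineSubspace.direction_top]

theorem ne_zero_of_finrank_dirFace (h : (interior C).Nonempty)
    (hd : Module.finrank ℝ (vectorSpan ℝ (dirFace C m)) < Module.finrank ℝ V) : m ≠ 0 := by
  rintro rfl
  rw [dirFace_zero, vectorSpan_eq_top_of_interior_nonempty h, finrank_top] at hd
  exact lt_irrefl _ hd

theorem not_subset_dirFace (h : (interior C).Nonempty) (hm : m ≠ 0) : ¬C ⊆ dirFace C m := by
  obtain ⟨y, hy⟩ := h
  exact fun hsub => notMem_interior_of_mem_dirFace hm (hsub (interior_subset hy)) hy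

section FiniteDimensional

variable [FiniteDimensional ℝ V]

theorem orthogonal_eq_span_singleton {S : Submodule ℝ V}
    (hd : Module.finrank ℝ S + 1 = Module.finrank ℝ V) (hm : m ∈ Sᗮ) (h0 : m ≠ 0) :
    Sᗮ = ℝ ∙ m := by
  symm
  refine Submodule.eq_of_le_of_finrank_eq ((Submodule.span_singleton_le_iff_mem _ _).2 hm) ?_
  rw [finrank_span_singleton h0]
  have := S.finrank_add_finrank_orthogonal
  omega

theorem finrank_lt_finrank_of_orthogonal_ne_zero {S : Submodule ℝ V} (hm : m ∈ Sᗮ)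
    (h0 : m ≠ 0) : Module.finrank ℝ S < Module.finrank ℝ V := by
  refine Submodule.finrank_lt fun htop => h0 ?_
  rwa [htop, Submodule.top_orthogonal_eq_bot, Submodule.mem_bot] at hm

theorem exists_dirFace_inter_dirFace_eq {W : Set V} (hW : W.Finite)
    (hi : (interior (convexHull ℝ W)).Nonempty)
    (hm : Module.finrank ℝ (vectorSpan ℝ (dirFace (convexHull ℝ W) m)) + 1 = Module.finrank ℝ V)
    (hl : Module.finrank ℝ (vectorSpan ℝ (dirFace (dirFace (convexHull ℝ W) m) l)) + 2 =
      Module.finrank ℝ V)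
    (hne : (dirFace (dirFace (convexHull ℝ W) m) l).Nonempty) :
    ∃ m', Module.finrank ℝ (vectorSpan ℝ (dirFace (convexHull ℝ W) m')) + 1 = Module.finrank ℝ V ∧
      dirFace (convexHull ℝ W) m ∩ dirFace (convexHull ℝ W) m' =
        dirFace (dirFace (convexHull ℝ W) m) l := by
  set C := convexHull ℝ W
  obtain ⟨x, hx⟩ := hne
  obtain ⟨c, hxc, w, hwc, hwm⟩ := exists_tilted_mem_dirFace hW
    (not_subset_dirFace hi (ne_zero_of_finrank_dirFace hi (by omega))) hx
  have hinter := dirFace_inter_dirFace_smul_add ⟨x, hx.1, hxc⟩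
  refine ⟨c • m + l, ?_, hinter⟩
  have hc0 : c • m + l ≠ 0 := by
    intro h0
    rw [← hinter, h0, dirFace_zero, inter_eq_left.2 (dirFace_subset C m)] at hl
    omega
  have hlt : vectorSpan ℝ (dirFace (dirFace C m) l) < vectorSpan ℝ (dirFace C (c • m + l)) := by
    refine lt_of_le_of_ne (vectorSpan_mono ℝ (hinter ▸ inter_subset_right)) fun heq => ?_
    have hm_orth : m ∈ (vectorSpan ℝ (dirFace C (c • m + l)))ᗮ := heq ▸
      mem_orthogonal_vectorSpan_iff.2 fun y hy z hz => inner_eq_of_mem_dirFace hy.1 hz.1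
    exact (inner_lt_of_notMem_dirFace hx.1 hwc.1 hwm).ne
      (mem_orthogonal_vectorSpan_iff.1 hm_orth w hwc x hxc)
  have hupper :=
    finrank_lt_finrank_of_orthogonal_ne_zero (mem_orthogonal_vectorSpan_dirFace C _) hc0
  have hlower := Submodule.finrank_lt_finrank_of_lt hlt
  omega

end FiniteDimensional

theorem eventually_add_mem_of_inner_neg {D : Set V} (hD : Convex ℝ D) {m' u v : V}
    (hG : G ⊆ D) (hx : x ∈ intrinsicInterior ℝ G)
    (hGV : ∀ g, inner ℝ m g = 0 → inner ℝ m' g = 0 → g ∈ vectorSpan ℝ G)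
    (hu : x + u ∈ D) (hv : x + v ∈ D) (hmu : inner ℝ m u = 0) (hm'u : inner ℝ m' u < 0)
    (hmv : inner ℝ m v < 0) (hm'v : inner ℝ m' v = 0) :
    ∀ᶠ z in 𝓝 (0 : V), inner ℝ m z < 0 → inner ℝ m' z < 0 → x + z ∈ D := by
  set α : V → ℝ := fun z => inner ℝ m' z / inner ℝ m' u with hα
  set β : V → ℝ := fun z => inner ℝ m z / inner ℝ m v with hβ
  set g : V → V := fun z => z - α z • u - β z • v with hg
  have hgV (z : V) : g z ∈ vectorSpan ℝ G := by
    refine hGV _ ?_ ?_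
    · simp [hg, hβ, inner_sub_right, inner_smul_right, hmu, div_mul_cancel₀ _ hmv.ne]
    · simp [hg, hα, inner_sub_right, inner_smul_right, hm'v, div_mul_cancel₀ _ hm'u.ne]
  have hgG : ∀ᶠ z in 𝓝 (0 : V), x + (2 : ℝ) • g z ∈ G := by
    have htendsto : Tendsto (fun z => (2 : ℝ) • g z) (𝓝 0) (𝓝[(vectorSpan ℝ G : Set V)] 0) :=
      tendsto_nhdsWithin_iff.2 ⟨Continuous.tendsto' (by fun_prop) _ _ (by simp [hg, hα, hβ]),
        Eventually.of_forall fun z => Submodule.smul_mem _ _ (hgV z)⟩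
    exact htendsto.eventually (eventually_add_mem_of_mem_intrinsicInterior hx)
  have hsmall : ∀ᶠ z in 𝓝 (0 : V), α z + β z < 1 / 2 :=
    (Continuous.tendsto' (by fun_prop) _ _ (by simp [hα, hβ])).eventually_lt_const one_half_pos
  filter_upwards [hgG, hsmall] with z hzG hz hm hm'
  have hα0 : 0 < α z := div_pos_of_neg_of_neg hm' hm'u
  have hβ0 : 0 < β z := div_pos_of_neg_of_neg hm hmv
  have hconv := hD.sum_mem (t := Finset.univ) (w := ![1 / 2, α z, β z, 1 / 2 - α z - β z])
    (z := ![x + (2 : ℝ) • g z, x + u, x + v, x]) ?_ ?_ ?_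
  · convert hconv using 1
    simp only [Fin.sum_univ_four, Matrix.cons_val, hg]
    module
  · simp [Fin.forall_fin_succ, hα0.le, hβ0.le]
    linarith
  · simp only [Fin.sum_univ_four, Matrix.cons_val]
    ring
  · simp [Fin.forall_fin_succ, hG hzG, hu, hv, hG (intrinsicInterior_subset hx)]

theorem eventually_add_smul_mem_interior {D : Set V} {m' w : V}
    (hD : ∀ᶠ z in 𝓝 (0 : V), inner ℝ m z < 0 → inner ℝ m' z < 0 → x + z ∈ D)
    (hw : inner ℝ m w < 0) (hw' : inner ℝ m' w < 0) :
    ∀ᶠ ε in 𝓝[>] (0 : ℝ), x + ε • w ∈ interior D := by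
  have hline : Tendsto (fun ε : ℝ => ε • w) (𝓝[>] 0) (𝓝 0) :=
    (Continuous.tendsto' (by fun_prop) 0 _ (zero_smul ℝ w)).mono_left nhdsWithin_le_nhds
  filter_upwards [hline.eventually hD.eventually_nhds, self_mem_nhdsWithin] with ε hε hpos
  have hneg (n : V) (hn : inner ℝ n w < 0) : ∀ᶠ z in 𝓝 (ε • w), inner ℝ n z < 0 := by
    refine (Continuous.tendsto (by fun_prop) _).eventually_lt_const ?_
    rw [inner_smul_right]
    exact mul_neg_of_pos_of_neg hpos hn
  have hnhds : ∀ᶠ z in 𝓝 (ε • w), x + z ∈ D := by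
    filter_upwards [hε, hneg m hw, hneg m' hw'] with z hz hzm hzm' using hz hzm hzm'
  rw [mem_interior_iff_mem_nhds, ← map_add_left_nhds]
  exact hnhds

end Faces

section FacesOfBodies

open Set Filter Topology

variable {V : Type*} [NormedAddCommGroup V] [InnerProductSpace ℝ V] {C F : Set V} {m l : V}

omit [InnerProductSpace ℝ V] in
theorem neg_vadd_set (t : V) (F : Set V) : -(t +ᵥ F) = -t +ᵥ -F := by
  ext x
  simp only [Set.mem_neg, mem_vadd_set_iff_neg_vadd_mem, vadd_eq_add, neg_add, neg_neg]

theorem dirFace_neg (C : Set V) (m : V) : dirFace (-C) m = -dirFace C (-m) := by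
  ext x
  simp only [dirFace, Set.mem_neg, mem_ofPred_eq]
  refine and_congr_right fun _ => ⟨fun h y hy => ?_, fun h y hy => ?_⟩
  · simpa using h (-y) (by simpa using hy)
  · simpa using h _ hy

theorem vadd_injective_of_isCompact (hF : IsCompact F) (hne : F.Nonempty) :
    Function.Injective fun t : V => t +ᵥ F := by
  have hzero {t : V} (h : t +ᵥ F = F) : t = 0 := by
    obtain ⟨x, hx, hmax⟩ := hF.exists_isMaxOn hne (f := fun x => inner ℝ t x) (by fun_prop)
    have hle : inner ℝ t (t + x) ≤ inner ℝ t x := hmax (h ▸ vadd_mem_vadd_set hx : t + x ∈ F)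
    rw [inner_add_right] at hle
    exact real_inner_self_nonpos.1 (by linarith)
  intro s t (h : s +ᵥ F = t +ᵥ F)
  exact sub_eq_zero.1 (hzero (by rw [sub_eq_neg_add, add_vadd, h, neg_vadd_vadd]))

theorem isCompact_dirFace (hC : IsCompact C) (m : V) : IsCompact (dirFace C m) := by
  rcases (dirFace C m).eq_empty_or_nonempty with h | ⟨x, hx⟩
  · rw [h]
    exact isCompact_empty
  · have : dirFace C m = C ∩ {y | inner ℝ m y = inner ℝ m x} := ext fun y => mem_dirFace_iff hx
    rw [this]
    exact hC.inter_right (isClosed_eq (by fun_prop) continuous_const)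

theorem dirFace_eq_of_subset [FiniteDimensional ℝ V] (hne : (dirFace C m).Nonempty)
    (hd : Module.finrank ℝ (vectorSpan ℝ (dirFace C m)) + 1 = Module.finrank ℝ V) (hm : m ≠ 0)
    (hl : l ≠ 0) (hsub : dirFace C m ⊆ dirFace C l) : dirFace C l = dirFace C m := by
  obtain ⟨x, hx⟩ := hne
  have hl_orth : l ∈ (vectorSpan ℝ (dirFace C m))ᗮ :=
    mem_orthogonal_vectorSpan_iff.2 fun y hy z hz => inner_eq_of_mem_dirFace (hsub hy) (hsub hz)
  rw [orthogonal_eq_span_singleton hd (mem_orthogonal_vectorSpan_dirFace C m) hm,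
    Submodule.mem_span_singleton] at hl_orth
  obtain ⟨a, rfl⟩ := hl_orth
  refine Subset.antisymm (fun y hy => (mem_dirFace_iff hx).2 ⟨hy.1, ?_⟩) hsub
  have heq := inner_eq_of_mem_dirFace hy (hsub hx)
  rw [real_inner_smul_left, real_inner_smul_left] at heq
  exact mul_left_cancel₀ (left_ne_zero_of_smul hl) heq

end FacesOfBodies

section GeneralPosition

open MeasureTheory Set

variable {V : Type*} [NormedAddCommGroup V] [NormedSpace ℝ V] [FiniteDimensional ℝ V]

theorem exists_mem_forall_disjoint_segment {S : Set (Set V)} (hS : S.Countable)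
    (hfin : ∀ K ∈ S, Module.finrank ℝ (vectorSpan ℝ K) + 2 ≤ Module.finrank ℝ V) {p : V}
    (hp : ∀ K ∈ S, p ∉ K) {U : Set V} (hU : IsOpen U) (hne : U.Nonempty) :
    ∃ q ∈ U, ∀ K ∈ S, Disjoint (segment ℝ p q) K := by
  borelize V
  have hnull : Measure.addHaar (⋃ K ∈ S, (affineSpan ℝ (insert p K) : Set V)) = 0 := by
    refine (measure_biUnion_null_iff hS).2 fun K hK =>
      Measure.addHaar_affineSubspace _ _ fun htop => ?_
    have hle := finrank_vectorSpan_insert_le_set ℝ K p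
    rw [← direction_affineSpan ℝ (insert p K), htop, AffineSubspace.direction_top,
      finrank_top] at hle
    have := hfin K hK
    omega
  obtain ⟨q, hqU, hq⟩ : ∃ q ∈ U, q ∉ ⋃ K ∈ S, (affineSpan ℝ (insert p K) : Set V) := by
    by_contra! hcon
    exact (hU.measure_pos Measure.addHaar hne).ne' (measure_mono_null hcon hnull)
  refine ⟨q, hqU, fun K hK => disjoint_left.2 fun z hz hzK => hq (mem_iUnion₂.2 ⟨K, hK, ?_⟩)⟩
  rw [segment_eq_image_lineMap] at hz
  obtain ⟨s, -, rfl⟩ := hz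
  have hs : s ≠ 0 := by
    rintro rfl
    rw [AffineMap.lineMap_apply_zero] at hzK
    exact hp K hK hzK
  have hmem := AffineMap.lineMap_mem s⁻¹ (mem_affineSpan ℝ (mem_insert p K))
    (mem_affineSpan ℝ (mem_insert_of_mem p hzK))
  rwa [AffineMap.lineMap_lineMap_right, inv_mul_cancel₀ hs, AffineMap.lineMap_apply_one] at hmem

end GeneralPosition

section Tilings

open Set Filter Topology MeasureTheory

variable {d : ℕ} {P : Set (EuclideanSpace ℝ (Fin d))} {𝒯 : Set (Set (EuclideanSpace ℝ (Fin d)))}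
  {C C' F : Set (EuclideanSpace ℝ (Fin d))}

theorem isFace_iff : IsFace C F ↔ F.Nonempty ∧ ∃ m, F = dirFace C m := by
  refine and_congr_right fun hne => ⟨fun h => ?_, fun ⟨m, h⟩ _ => ?_⟩
  · obtain ⟨l, hl⟩ := h hne
    refine ⟨(InnerProductSpace.toDual ℝ _).symm l, ?_⟩
    simp only [dirFace, InnerProductSpace.toDual_symm_apply]
    exact hl
  · exact ⟨InnerProductSpace.toDual ℝ _ m, h⟩

namespace IsParallelohedronTiling

theorem exists_finite_convexHull (h : IsParallelohedronTiling P 𝒯) (hC : C ∈ 𝒯) :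
    ∃ W : Set (EuclideanSpace ℝ (Fin d)), W.Finite ∧ C = convexHull ℝ W := by
  obtain ⟨v, rfl⟩ := h.translates C hC
  obtain ⟨W, hW, hP⟩ := h.polytope
  exact ⟨v +ᵥ W, hW.vadd_set, by rw [hP, convexHull_vadd]⟩

theorem convex (h : IsParallelohedronTiling P 𝒯) (hC : C ∈ 𝒯) : Convex ℝ C := by
  obtain ⟨W, -, rfl⟩ := h.exists_finite_convexHull hC
  exact convex_convexHull ℝ W

theorem isCompact (h : IsParallelohedronTiling P 𝒯) (hC : C ∈ 𝒯) : IsCompact C := by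
  obtain ⟨W, hW, rfl⟩ := h.exists_finite_convexHull hC
  exact hW.isCompact_convexHull ℝ

theorem interior_nonempty (h : IsParallelohedronTiling P 𝒯) (hC : C ∈ 𝒯) :
    (interior C).Nonempty := by
  obtain ⟨v, rfl⟩ := h.translates C hC
  rw [interior_vadd]
  exact h.full_dimensional.vadd_set

theorem nonempty (h : IsParallelohedronTiling P 𝒯) (hC : C ∈ 𝒯) : C.Nonempty :=
  (h.interior_nonempty hC).mono interior_subset

theorem exists_mem_cell (h : IsParallelohedronTiling P 𝒯) (x : EuclideanSpace ℝ (Fin d)) :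
    ∃ C ∈ 𝒯, x ∈ C :=
  (h.covers ▸ mem_univ x : x ∈ ⋃₀ 𝒯)

theorem exists_vadd_eq (h : IsParallelohedronTiling P 𝒯) (hC : C ∈ 𝒯) (hC' : C' ∈ 𝒯) :
    ∃ t : EuclideanSpace ℝ (Fin d), C' = t +ᵥ C := by
  obtain ⟨x, rfl⟩ := h.translates C hC
  obtain ⟨y, rfl⟩ := h.translates C' hC'
  exact ⟨y - x, by rw [vadd_vadd, sub_add_cancel]⟩

theorem vadd_injective (h : IsParallelohedronTiling P 𝒯) (hC : C ∈ 𝒯) :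
    Function.Injective fun t : EuclideanSpace ℝ (Fin d) => t +ᵥ C :=
  vadd_injective_of_isCompact (h.isCompact hC) (h.nonempty hC)

theorem closure_interior_eq (h : IsParallelohedronTiling P 𝒯) (hC : C ∈ 𝒯) :
    closure (interior C) = C := by
  rw [(h.convex hC).closure_interior_eq_closure_of_nonempty_interior (h.interior_nonempty hC),
    (h.isCompact hC).isClosed.closure_eq]

theorem countable (h : IsParallelohedronTiling P 𝒯) : 𝒯.Countable :=
  PairwiseDisjoint.countable_of_isOpen (s := interior) h.disjoint_interiors
    (fun _ _ => isOpen_interior) (fun _ hC => h.interior_nonempty hC)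

theorem disjoint_interior_cell (h : IsParallelohedronTiling P 𝒯) (hC : C ∈ 𝒯) (hC' : C' ∈ 𝒯)
    (hne : C ≠ C') : Disjoint (interior C) C' := by
  rw [← h.closure_interior_eq hC']
  exact (h.disjoint_interiors C hC C' hC' hne).closure_right isOpen_interior

theorem subset_closedBall (h : IsParallelohedronTiling P 𝒯) (hC : C ∈ 𝒯)
    {x : EuclideanSpace ℝ (Fin d)} {r : ℝ} (hne : (C ∩ Metric.closedBall x r).Nonempty) :
    C ⊆ Metric.closedBall x (Metric.diam P + r) := by
  obtain ⟨z, hzC, hzx⟩ := hne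
  intro y hy
  have hdiam : Metric.diam C = Metric.diam P := by
    obtain ⟨v, rfl⟩ := h.translates C hC
    exact diam_vadd v P
  have hyz := Metric.dist_le_diam_of_mem (h.isCompact hC).isBounded hy hzC
  rw [hdiam] at hyz
  exact (dist_triangle y z x).trans (add_le_add hyz hzx)

theorem locallyFinite (h : IsParallelohedronTiling P 𝒯) :
    LocallyFinite fun C : 𝒯 => (C : Set (EuclideanSpace ℝ (Fin d))) := by
  refine fun x => ⟨Metric.closedBall x 1, Metric.closedBall_mem_nhds x one_pos, ?_⟩
  set S := {C : 𝒯 | ((C : Set (EuclideanSpace ℝ (Fin d))) ∩ Metric.closedBall x 1).Nonempty}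
  have hfin := Measure.finite_const_le_meas_of_disjoint_iUnion
    (volume : Measure (EuclideanSpace ℝ (Fin d))) (ε := volume (interior P))
    (As := fun C : S => interior (C.1 : Set (EuclideanSpace ℝ (Fin d))))
    (isOpen_interior.measure_pos _ h.full_dimensional) (fun C => isOpen_interior.measurableSet)
    (fun C C' hne => h.disjoint_interiors _ C.1.2 _ C'.1.2
      fun e => hne (Subtype.ext (Subtype.ext e)))
    (measure_mono (iUnion_subset fun C => interior_subset.trans (h.subset_closedBall C.1.2 C.2))
      |>.trans_lt measure_closedBall_lt_top).ne
  have huniv : {C : S | volume (interior P) ≤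
      volume (interior (C.1 : Set (EuclideanSpace ℝ (Fin d))))} = univ := by
    refine eq_univ_of_forall fun C => ?_
    obtain ⟨v, hv⟩ := h.translates _ C.1.2
    simp only [mem_ofPred_eq, hv, interior_vadd, measure_vadd, le_refl]
  rw [huniv, finite_univ_iff] at hfin
  exact S.toFinite

theorem isClosed_sUnion (h : IsParallelohedronTiling P 𝒯)
    {S : Set (Set (EuclideanSpace ℝ (Fin d)))} (hS : S ⊆ 𝒯) : IsClosed (⋃₀ S) := by
  rw [sUnion_eq_iUnion]
  exact (h.locallyFinite.comp_injective (inclusion_injective hS)).isClosed_iUnion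
    fun C => (h.isCompact (hS C.2)).isClosed

theorem ne_zero_of_inter_eq (h : IsParallelohedronTiling P 𝒯) (hC : C ∈ 𝒯) (hC' : C' ∈ 𝒯)
    (hne : C ≠ C') {l : EuclideanSpace ℝ (Fin d)} (hl : C ∩ C' = dirFace C l) : l ≠ 0 := by
  rintro rfl
  rw [dirFace_zero, inter_eq_left] at hl
  obtain ⟨x, hx⟩ := h.interior_nonempty hC
  exact disjoint_left.1 (h.disjoint_interior_cell hC hC' hne) hx (hl (interior_subset hx))

theorem exists_inter_eq_dirFace (h : IsParallelohedronTiling P 𝒯) (hC : C ∈ 𝒯) (hC' : C' ∈ 𝒯)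
    (hne : C ≠ C') (hn : (C ∩ C').Nonempty) : ∃ m ≠ 0, C ∩ C' = dirFace C m := by
  obtain ⟨-, m, hm⟩ := isFace_iff.1 (h.face_to_face C hC C' hC' hn).1
  exact ⟨m, h.ne_zero_of_inter_eq hC hC' hne hm, hm⟩

theorem inter_eq_dirFace_neg (h : IsParallelohedronTiling P 𝒯) (hC : C ∈ 𝒯) (hC' : C' ∈ 𝒯)
    (hne : C ≠ C') (hn : (C ∩ C').Nonempty)
    (hd : Module.finrank ℝ (vectorSpan ℝ (C ∩ C')) + 1 = d) {m : EuclideanSpace ℝ (Fin d)}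
    (hm : C ∩ C' = dirFace C m) : C ∩ C' = dirFace C' (-m) := by
  obtain ⟨l, hl0, hl⟩ := h.exists_inter_eq_dirFace hC' hC hne.symm (inter_comm C C' ▸ hn)
  rw [inter_comm] at hl
  have hl_orth := mem_orthogonal_vectorSpan_dirFace C' l
  have hm_orth := mem_orthogonal_vectorSpan_dirFace C m
  rw [← hl, orthogonal_eq_span_singleton (by simpa using hd) (hm ▸ hm_orth)
    (h.ne_zero_of_inter_eq hC hC' hne hm), Submodule.mem_span_singleton] at hl_orth
  obtain ⟨b, rfl⟩ := hl_orth
  rcases (left_ne_zero_of_smul hl0).lt_or_gt with hb | hb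
  · rw [hl, ← neg_smul_neg, dirFace_smul _ _ (neg_pos.2 hb)]
  · -- Otherwise the face of `C'` in the direction `m` would be a nontrivial translate of itself.
    obtain ⟨t, rfl⟩ := h.exists_vadd_eq hC hC'
    rw [dirFace_smul _ _ hb, hm, dirFace_vadd] at hl
    have ht : (0 : EuclideanSpace ℝ (Fin d)) = t :=
      vadd_injective_of_isCompact (isCompact_dirFace (h.isCompact hC) m) (hm ▸ hn)
        (by simpa only [zero_vadd] using hl)
    exact absurd (by rw [← ht, zero_vadd]) hne

theorem exists_ne_mem_of_mem_dirFace (h : IsParallelohedronTiling P 𝒯)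
    {m x : EuclideanSpace ℝ (Fin d)} (hm : m ≠ 0) (hx : x ∈ dirFace C m) :
    ∃ C' ∈ 𝒯, C ≠ C' ∧ x ∈ C' := by
  by_contra! hcon
  have hnear : ∀ᶠ t in 𝓝[>] (0 : ℝ), x + t • m ∉ ⋃₀ (𝒯 \ {C}) :=
    ((Continuous.tendsto' (by fun_prop) (0 : ℝ) x (by simp)).mono_left
      nhdsWithin_le_nhds).eventually ((h.isClosed_sUnion sdiff_subset).isOpen_compl.mem_nhds
        fun ⟨C', hC', hxC'⟩ => hcon C' hC'.1 (Ne.symm hC'.2) hxC')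
  obtain ⟨t, ht, ht0 : 0 < t⟩ := (hnear.and self_mem_nhdsWithin).exists
  obtain ⟨C', hC', hxC'⟩ := h.exists_mem_cell (x + t • m)
  obtain rfl : C' = C := by_contra fun hne => ht ⟨C', ⟨hC', hne⟩, hxC'⟩
  have hle := hx.2 _ hxC'
  rw [inner_add_right, inner_smul_right] at hle
  linarith [mul_pos ht0 (real_inner_self_pos.2 hm)]

theorem exists_neighbour (h : IsParallelohedronTiling P 𝒯) (hC : C ∈ 𝒯)
    {m : EuclideanSpace ℝ (Fin d)} (hn : (dirFace C m).Nonempty)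
    (hd : Module.finrank ℝ (vectorSpan ℝ (dirFace C m)) + 1 = d) :
    ∃ C' ∈ 𝒯, C ≠ C' ∧ C ∩ C' = dirFace C m ∧ C ∩ C' = dirFace C' (-m) := by
  have hm0 : m ≠ 0 := ne_zero_of_finrank_dirFace (h.interior_nonempty hC) (by simp; omega)
  obtain ⟨x, hx⟩ := hn.intrinsicInterior (convex_dirFace (h.convex hC) m)
  have hxm := intrinsicInterior_subset hx
  obtain ⟨C', hC', hne, hxC'⟩ := h.exists_ne_mem_of_mem_dirFace hm0 hxm
  have hn' : (C ∩ C').Nonempty := ⟨x, hxm.1, hxC'⟩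
  obtain ⟨l, hl0, hl⟩ := h.exists_inter_eq_dirFace hC hC' hne hn'
  have hsub : dirFace C m ⊆ dirFace C l :=
    subset_dirFace_of_mem_intrinsicInterior hx (dirFace_subset C m) (hl ▸ ⟨hxm.1, hxC'⟩)
  have heq : C ∩ C' = dirFace C m := by
    rw [hl, dirFace_eq_of_subset hn (by simpa using hd) hm0 hl0 hsub]
  exact ⟨C', hC', hne, heq, h.inter_eq_dirFace_neg hC hC' hne hn' (by rwa [heq]) heq⟩

theorem vadd_mem_of_finrank_inter (h : IsParallelohedronTiling P 𝒯) (hC : C ∈ 𝒯)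
    {t : EuclideanSpace ℝ (Fin d)} (ht : t +ᵥ C ∈ 𝒯) (hne : C ≠ t +ᵥ C)
    (hn : (C ∩ (t +ᵥ C)).Nonempty)
    (hd : Module.finrank ℝ (vectorSpan ℝ (C ∩ (t +ᵥ C))) + 1 = d) (hC' : C' ∈ 𝒯) :
    t +ᵥ C' ∈ 𝒯 := by
  obtain ⟨m, -, hm⟩ := h.exists_inter_eq_dirFace hC ht hne hn
  have hm' := h.inter_eq_dirFace_neg hC ht hne hn hd hm
  obtain ⟨s, rfl⟩ := h.exists_vadd_eq hC hC'
  obtain ⟨D, hD, -, hDm, hDm'⟩ := h.exists_neighbour hC' (m := m)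
    (by rw [dirFace_vadd, ← hm]; exact hn.vadd_set)
    (by rwa [dirFace_vadd, vectorSpan_vadd, ← hm])
  obtain ⟨r, rfl⟩ := h.exists_vadd_eq hC hD
  rw [hm, dirFace_vadd] at hm'
  rw [hDm, dirFace_vadd, dirFace_vadd, hm', vadd_vadd] at hDm'
  have hne' : (dirFace C (-m)).Nonempty := by
    rw [hm, hm'] at hn
    exact vadd_set_nonempty.1 hn
  have hr : s + t = r :=
    vadd_injective_of_isCompact (isCompact_dirFace (h.isCompact hC) (-m)) hne' hDm'
  rwa [vadd_vadd, add_comm, hr]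

end IsParallelohedronTiling

namespace IsParallelohedronTiling

theorem mem_stabilizer_of_finrank_inter (h : IsParallelohedronTiling P 𝒯) (hC : C ∈ 𝒯)
    {t : EuclideanSpace ℝ (Fin d)} (ht : t +ᵥ C ∈ 𝒯) (hne : C ≠ t +ᵥ C)
    (hn : (C ∩ (t +ᵥ C)).Nonempty)
    (hd : Module.finrank ℝ (vectorSpan ℝ (C ∩ (t +ᵥ C))) + 1 = d) :
    t ∈ AddAction.stabilizer (EuclideanSpace ℝ (Fin d)) 𝒯 := by
  have hback : -t +ᵥ (t +ᵥ C) = C := neg_vadd_vadd t C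
  refine Subset.antisymm ?_ fun C' hC' => mem_vadd_set_iff_neg_vadd_mem.2 ?_
  · rintro _ ⟨C', hC', rfl⟩
    exact h.vadd_mem_of_finrank_inter hC ht hne hn hd hC'
  · refine h.vadd_mem_of_finrank_inter ht (hback.symm ▸ hC) ?_ ?_ ?_ hC' <;> rw [hback]
    · exact hne.symm
    · rwa [inter_comm]
    · rwa [inter_comm]

theorem finrank_inter_add_two_le (h : IsParallelohedronTiling P 𝒯) (hC : C ∈ 𝒯) (hC' : C' ∈ 𝒯)
    (horbit : C' ∉ AddAction.orbit (AddAction.stabilizer (EuclideanSpace ℝ (Fin d)) 𝒯) C)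
    (hn : (C ∩ C').Nonempty) : Module.finrank ℝ (vectorSpan ℝ (C ∩ C')) + 2 ≤ d := by
  have hne : C ≠ C' := fun e => horbit (e ▸ AddAction.mem_orbit_self C)
  obtain ⟨m, hm0, hm⟩ := h.exists_inter_eq_dirFace hC hC' hne hn
  have hlt :=
    finrank_lt_finrank_of_orthogonal_ne_zero (hm ▸ mem_orthogonal_vectorSpan_dirFace C m) hm0
  rw [finrank_euclideanSpace_fin] at hlt
  by_contra hcon
  obtain ⟨t, rfl⟩ := h.exists_vadd_eq hC hC'
  exact horbit ⟨⟨t, h.mem_stabilizer_of_finrank_inter hC hC' hne hn (by omega)⟩, rfl⟩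

theorem mem_orbit_stabilizer (h : IsParallelohedronTiling P 𝒯) (hC : C ∈ 𝒯) (hC' : C' ∈ 𝒯) :
    C' ∈ AddAction.orbit (AddAction.stabilizer (EuclideanSpace ℝ (Fin d)) 𝒯) C := by
  set L := AddAction.stabilizer (EuclideanSpace ℝ (Fin d)) 𝒯
  by_contra hC'_orbit
  set A := 𝒯 ∩ AddAction.orbit L C
  set B := 𝒯 \ AddAction.orbit L C
  have horbit {D D'} (hD : D ∈ A) (hD' : D' ∈ B) : D' ∉ AddAction.orbit L D := fun hmem =>
    hD'.2 (AddAction.orbit_eq_iff.2 hD.2 ▸ hmem)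
  obtain ⟨p, hp⟩ := h.interior_nonempty hC
  have hAB_countable : {K | ∃ D ∈ A, ∃ D' ∈ B, K = D ∩ D' ∧ K.Nonempty}.Countable := by
    refine ((h.countable.prod h.countable).image fun D => D.1 ∩ D.2).mono ?_
    rintro _ ⟨D, hD, D', hD', rfl, -⟩
    exact ⟨(D, D'), ⟨hD.1, hD'.1⟩, rfl⟩
  obtain ⟨q, hq, hpq⟩ := exists_mem_forall_disjoint_segment hAB_countable (p := p)
    (by
      rintro _ ⟨D, hD, D', hD', rfl, hn⟩
      simpa using h.finrank_inter_add_two_le hD.1 hD'.1 (horbit hD hD') hn)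
    (by
      rintro _ ⟨D, -, D', hD', rfl, -⟩ hpD
      have hne : C ≠ D' := fun e => hD'.2 (e ▸ AddAction.mem_orbit_self C)
      exact disjoint_left.1 (h.disjoint_interior_cell hC hD'.1 hne) hp hpD.2)
    isOpen_interior (h.interior_nonempty hC')
  obtain ⟨z, hz, ⟨D, hD, hzD⟩, D', hD', hzD'⟩ := isPreconnected_closed_iff.1
    (convex_segment p q).isPreconnected (⋃₀ A) (⋃₀ B) (h.isClosed_sUnion inter_subset_left)
    (h.isClosed_sUnion sdiff_subset)
    (by rw [← sUnion_union, inter_union_sdiff, h.covers]; exact subset_univ _)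
    ⟨p, left_mem_segment ℝ p q, C, ⟨hC, AddAction.mem_orbit_self C⟩, interior_subset hp⟩
    ⟨q, right_mem_segment ℝ p q, C', ⟨hC', hC'_orbit⟩, interior_subset hq⟩
  exact disjoint_left.1 (hpq _ ⟨D, hD, D', hD', rfl, z, hzD, hzD'⟩) hz ⟨hzD, hzD'⟩

theorem exists_mem_stabilizer_vadd_eq (h : IsParallelohedronTiling P 𝒯) (hC : C ∈ 𝒯)
    (hC' : C' ∈ 𝒯) :
    ∃ t ∈ AddAction.stabilizer (EuclideanSpace ℝ (Fin d)) 𝒯, C' = t +ᵥ C := by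
  obtain ⟨t, ht⟩ := h.mem_orbit_stabilizer hC hC'
  exact ⟨t, t.2, ht.symm⟩

end IsParallelohedronTiling

end Tilings

section CellSymmetry

open Set MeasureTheory

variable {d : ℕ} {P : Set (EuclideanSpace ℝ (Fin d))} {𝒯 : Set (Set (EuclideanSpace ℝ (Fin d)))}
  {C C' : Set (EuclideanSpace ℝ (Fin d))}

theorem measure_sub_self_le {V : Type*} [NormedAddCommGroup V] [NormedSpace ℝ V]
    [FiniteDimensional ℝ V] [MeasurableSpace V] [BorelSpace V] {μ : Measure V}
    [μ.IsAddHaarMeasure] {K : Set V} (hK : Convex ℝ K) (hi : (interior K).Nonempty) :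
    μ (K + -K) ≤ μ (interior K + -interior K) := by
  have hcl := hK.closure_interior_eq_closure_of_nonempty_interior hi
  have hsub : K + -K ⊆ closure (interior K + -interior K) := by
    rintro _ ⟨p, hp, q, hq, rfl⟩
    refine map_mem_closure₂ continuous_add (hcl ▸ subset_closure hp) ?_
      fun a ha b hb => add_mem_add ha hb
    rw [← neg_closure, hcl]
    exact subset_closure hq
  calc μ (K + -K) ≤ μ (closure (interior K + -interior K)) := measure_mono hsub
    _ ≤ μ (interior K + -interior K) + μ (frontier (interior K + -interior K)) := by
      rw [closure_eq_self_union_frontier]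
      exact measure_union_le _ _
    _ = μ (interior K + -interior K) := by
      rw [(hK.interior.add hK.interior.neg).addHaar_frontier μ, add_zero]

theorem vadd_mem_of_mem_stabilizer {t : EuclideanSpace ℝ (Fin d)}
    (ht : t ∈ AddAction.stabilizer (EuclideanSpace ℝ (Fin d)) 𝒯) (hC : C ∈ 𝒯) : t +ᵥ C ∈ 𝒯 :=
  ht ▸ vadd_mem_vadd_set hC

namespace IsParallelohedronTiling

theorem countable_stabilizer (h : IsParallelohedronTiling P 𝒯) (hC : C ∈ 𝒯) :
    Countable (AddAction.stabilizer (EuclideanSpace ℝ (Fin d)) 𝒯) := by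
  have := h.countable.to_subtype
  refine Function.Injective.countable (β := 𝒯)
    (f := fun t => ⟨t +ᵥ C, vadd_mem_of_mem_stabilizer t.2 hC⟩) fun s t hst => ?_
  exact Subtype.ext (h.vadd_injective hC (congrArg Subtype.val hst))

theorem isAddFundamentalDomain (h : IsParallelohedronTiling P 𝒯) (hC : C ∈ 𝒯) :
    IsAddFundamentalDomain (AddAction.stabilizer (EuclideanSpace ℝ (Fin d)) 𝒯) C volume := by
  refine ⟨(h.isCompact hC).measurableSet.nullMeasurableSet, ae_of_all _ fun p => ?_, ?_⟩
  · obtain ⟨C', hC', hp⟩ := h.exists_mem_cell p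
    obtain ⟨t, rfl⟩ := h.mem_orbit_stabilizer hC hC'
    exact ⟨-t, mem_vadd_set_iff_neg_vadd_mem.1 hp⟩
  · intro s t hst
    have hs := vadd_mem_of_mem_stabilizer s.2 hC
    have ht := vadd_mem_of_mem_stabilizer t.2 hC
    have hne : (s : EuclideanSpace ℝ (Fin d)) +ᵥ C ≠ (t : EuclideanSpace ℝ (Fin d)) +ᵥ C :=
      fun e => hst (Subtype.ext (h.vadd_injective hC e))
    refine measure_mono_null (fun p hp => ?_) ((h.convex hs).addHaar_frontier volume)
    exact ⟨subset_closure hp.1, fun hpi =>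
      disjoint_left.1 (h.disjoint_interior_cell hs ht hne) hpi hp.2⟩

/-- A nonzero lattice vector in `interior C - interior C` would make two cells overlap, so this is
Minkowski's convex body theorem. -/
theorem volume_interior_sub_le (h : IsParallelohedronTiling P 𝒯) (hC : C ∈ 𝒯) :
    volume (interior C + -interior C) ≤ volume C * 2 ^ d := by
  have := h.countable_stabilizer hC
  by_contra! hlt
  obtain ⟨v, hv0, p, hp, q, hq, hpq⟩ := exists_ne_zero_mem_lattice_of_measure_mul_two_pow_lt_measure
    (h.isAddFundamentalDomain hC) (s := interior C + -interior C)
    (by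
      rintro _ ⟨p, hp, q, hq, rfl⟩
      exact ⟨-q, hq, -p, by simpa using hp, by simp [add_comm]⟩)
    ((h.convex hC).interior.add (h.convex hC).interior.neg)
    (by rwa [finrank_euclideanSpace_fin])
  have hne : C ≠ (v : EuclideanSpace ℝ (Fin d)) +ᵥ C := fun e =>
    hv0 (Subtype.ext (h.vadd_injective hC (by simpa using e.symm)))
  refine disjoint_left.1 (h.disjoint_interiors _ hC _ (vadd_mem_of_mem_stabilizer v.2 hC) hne) hp ?_
  rw [interior_vadd, mem_vadd_set_iff_neg_vadd_mem, ← hpq]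
  simpa using hq

theorem exists_center (h : IsParallelohedronTiling P 𝒯) (hC : C ∈ 𝒯) :
    ∃ c, ∀ x ∈ C, c - x ∈ C := by
  have hne : volume C ≠ 0 :=
    (Measure.measure_pos_of_nonempty_interior volume (h.interior_nonempty hC)).ne'
  refine exists_center_of_measure_le (h.convex hC) (h.isCompact hC) hne ?_
  rw [Measure.addHaar_smul_of_nonneg _ (by norm_num), finrank_euclideanSpace_fin]
  calc ENNReal.ofReal (2⁻¹ ^ d) * volume (C + -C)
      ≤ ENNReal.ofReal (2⁻¹ ^ d) * (volume C * 2 ^ d) := by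
        gcongr
        exact (measure_sub_self_le (h.convex hC) (h.interior_nonempty hC)).trans
          (h.volume_interior_sub_le hC)
    _ = volume C := by
        rw [mul_left_comm, ENNReal.ofReal_pow (by norm_num), ← mul_pow,
          ENNReal.ofReal_inv_of_pos (by norm_num)]
        simp [ENNReal.inv_mul_cancel]

theorem exists_reflection (h : IsParallelohedronTiling P 𝒯) (hC : C ∈ 𝒯) :
    ∃ w : EuclideanSpace ℝ (Fin d), w +ᵥ -C = C ∧ ∀ C' ∈ 𝒯, w +ᵥ -C' ∈ 𝒯 := by
  obtain ⟨c, hc⟩ := h.exists_center hC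
  have hCc : c +ᵥ -C = C := by
    refine Subset.antisymm ?_ fun y hy => ⟨-(c - y), by simpa using hc y hy, by simp⟩
    rintro _ ⟨y, hy, rfl⟩
    simpa using hc _ hy
  refine ⟨c, hCc, fun C' hC' => ?_⟩
  obtain ⟨t, ht, rfl⟩ := h.exists_mem_stabilizer_vadd_eq hC hC'
  rw [neg_vadd_set, vadd_vadd, add_comm, add_vadd, hCc]
  exact vadd_mem_of_mem_stabilizer (neg_mem ht) hC

end IsParallelohedronTiling

end CellSymmetry

section PlaneFans

variable {V : Type*} [NormedAddCommGroup V] [InnerProductSpace ℝ V] {e : Fin 2 → V}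
  {a b c n w z : V}

/-- The oriented area spanned by the projections of `a` and `b` to the plane with the orthonormal
basis `e`; the oriented plane is given by this basis because `IsTraversalFrame` does so. -/
noncomputable def areaForm (e : Fin 2 → V) (a b : V) : ℝ :=
  inner ℝ (e 0) a * inner ℝ (e 1) b - inner ℝ (e 1) a * inner ℝ (e 0) b

theorem areaForm_self (e : Fin 2 → V) (a : V) : areaForm e a a = 0 := by
  rw [areaForm, mul_comm, sub_self]

theorem areaForm_swap (e : Fin 2 → V) (a b : V) : areaForm e a b = -areaForm e b a := by
  simp only [areaForm]
  ring

theorem areaForm_smul_left (e : Fin 2 → V) (t : ℝ) (a b : V) :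
    areaForm e (t • a) b = t * areaForm e a b := by
  simp only [areaForm, inner_smul_right]
  ring

theorem areaForm_neg_left (e : Fin 2 → V) (a b : V) : areaForm e (-a) b = -areaForm e a b := by
  simp only [areaForm, inner_neg_right]
  ring

theorem areaForm_sum_smul_right {ι : Type*} (s : Finset ι) (e : Fin 2 → V) (a : V) (t : ι → ℝ)
    (v : ι → V) : areaForm e a (∑ i ∈ s, t i • v i) = ∑ i ∈ s, t i * areaForm e a (v i) := by
  simp only [areaForm, inner_sum, inner_smul_right, Finset.mul_sum, ← Finset.sum_sub_distrib]
  exact Finset.sum_congr rfl fun i _ => by ring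

section OrthonormalFrame

variable (he : Orthonormal ℝ e)
include he

theorem inner_eq_of_mem_span_range (hw : w ∈ Submodule.span ℝ (Set.range e)) (z : V) :
    inner ℝ w z = inner ℝ (e 0) w * inner ℝ (e 0) z + inner ℝ (e 1) w * inner ℝ (e 1) z := by
  rw [Submodule.mem_span_range_iff_exists_fun] at hw
  obtain ⟨c, rfl⟩ := hw
  rw [he.inner_right_fintype, he.inner_right_fintype, sum_inner, Fin.sum_univ_two,
    real_inner_smul_left, real_inner_smul_left]

theorem areaForm_smul_eq (ha : a ∈ Submodule.span ℝ (Set.range e))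
    (hb : b ∈ Submodule.span ℝ (Set.range e)) (hc : c ∈ Submodule.span ℝ (Set.range e)) :
    areaForm e a b • c = areaForm e c b • a + areaForm e a c • b := by
  refine ext_inner_right ℝ fun z => ?_
  rw [inner_add_left, real_inner_smul_left, real_inner_smul_left, real_inner_smul_left,
    inner_eq_of_mem_span_range he ha, inner_eq_of_mem_span_range he hb,
    inner_eq_of_mem_span_range he hc]
  simp only [areaForm]
  ring

theorem inner_eq_areaForm_mul (hn : n ∈ Submodule.span ℝ (Set.range e)) (hn1 : ‖n‖ = 1)
    (hw : w ∈ Submodule.span ℝ (Set.range e)) (hz : inner ℝ n z = 0) :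
    inner ℝ w z = areaForm e z n * areaForm e w n := by
  have hnn : inner ℝ n n = (1 : ℝ) := by rw [real_inner_self_eq_norm_sq, hn1, one_pow]
  rw [inner_eq_of_mem_span_range he hn] at hnn hz
  rw [inner_eq_of_mem_span_range he hw]
  simp only [areaForm]
  linear_combination
    (-(inner ℝ (e 0) w * inner ℝ (e 0) z + inner ℝ (e 1) w * inner ℝ (e 1) z)) * hnn +
      (inner ℝ (e 0) w * inner ℝ (e 0) n + inner ℝ (e 1) w * inner ℝ (e 1) n) * hz

theorem mem_orthogonal_span_range (ha : a ∈ Submodule.span ℝ (Set.range e))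
    (hb : b ∈ Submodule.span ℝ (Set.range e)) (hab : areaForm e a b ≠ 0) (haz : inner ℝ a z = 0)
    (hbz : inner ℝ b z = 0) : z ∈ (Submodule.span ℝ (Set.range e))ᗮ := by
  rw [Submodule.mem_orthogonal]
  intro u hu
  refine (mul_eq_zero.1 ?_).resolve_left hab
  rw [← real_inner_smul_left, areaForm_smul_eq he ha hb hu, inner_add_left, real_inner_smul_left,
    real_inner_smul_left, haz, hbz, mul_zero, mul_zero, add_zero]

end OrthonormalFrame

theorem eq_of_smul_eq_smul_of_norm_eq (hnorm : ‖a‖ = ‖b‖) {r t : ℝ} (hr : 0 < r) (ht : 0 ≤ t)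
    (h : r • a = t • b) : a = b := by
  have hray : SameRay ℝ (r • a) (r • b) := by
    rw [h]
    exact (SameRay.sameRay_nonneg_smul_left b ht).trans (SameRay.sameRay_pos_smul_right b hr)
      fun hb => by simp [hb]
  exact smul_right_injective V hr.ne'
    ((sameRay_iff_of_norm_eq (by rw [norm_smul, norm_smul, hnorm])).1 hray)

/-- The unit vectors `v i` in the plane of `e` span the rays of a complete fan, in which `next i`
is the successor of `i` in the direction of traversal given by `e`: it is less than a half turn
ahead, and every other ray lies in the sector opposite to the one between `i` and `next i`. -/
structure IsPlaneFan {ι : Type*} (e : Fin 2 → V) (v : ι → V) (next : ι → ι) : Prop where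
  orthonormal : Orthonormal ℝ e
  mem_span : ∀ i, v i ∈ Submodule.span ℝ (Set.range e)
  norm_eq_one : ∀ i, ‖v i‖ = 1
  injective : Function.Injective v
  areaForm_pos : ∀ i, 0 < areaForm e (v i) (v (next i))
  areaForm_nonpos : ∀ i l, l ≠ i → l ≠ next i →
    areaForm e (v i) (v l) ≤ 0 ∧ areaForm e (v l) (v (next i)) ≤ 0

theorem sum_smul_eq_zero_of_forall_exists_eq_neg {ι : Type*} [Fintype ι] {v : ι → V}
    (hv : Function.Injective v) (hneg : ∀ i, ∃ l, v l = -v i) {x : ι → ℝ}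
    (hx : ∀ i l, v l = -v i → x l = x i) : ∑ i, x i • v i = 0 := by
  choose opp hopp using hneg
  have hinj : Function.Injective opp := fun i l hil => hv (by
    rw [← neg_inj, ← hopp i, ← hopp l, hil])
  have hsum : ∑ i, x i • v i = -∑ i, x i • v i := by
    rw [← Finset.sum_neg_distrib, ← hinj.bijective_of_finite.sum_comp]
    exact Finset.sum_congr rfl fun i _ => by rw [hx _ _ (hopp i), hopp i, smul_neg]
  have := IsAddTorsionFree.of_isTorsionFree ℝ V
  exact self_eq_neg.1 hsum

namespace IsPlaneFan

variable {ι : Type*} {v : ι → V} {next : ι → ι}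

theorem ne_next (hf : IsPlaneFan e v next) (i : ι) : next i ≠ i := fun h =>
  (hf.areaForm_pos i).ne' (by rw [h, areaForm_self])

theorem next_injective (hf : IsPlaneFan e v next) : Function.Injective next := by
  intro i l hil
  by_contra hne
  have hpos := hf.areaForm_pos l
  rw [← hil] at hpos
  exact hpos.not_ge (hf.areaForm_nonpos i l (Ne.symm hne) (hil ▸ (hf.ne_next l).symm)).2

theorem eq_neg_next (hf : IsPlaneFan e v next) {i l : ι} (hi : l ≠ i) (hnext : l ≠ next i)
    (hnext' : l ≠ next (next i)) : v l = -v (next i) := by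
  obtain ⟨hil, hl⟩ := hf.areaForm_nonpos i l hi hnext
  have hzero : areaForm e (v l) (v (next i)) = 0 := by
    have hl' := (hf.areaForm_nonpos (next i) l hnext hnext').1
    rw [areaForm_swap] at hl'
    linarith
  refine eq_of_smul_eq_smul_of_norm_eq (by rw [norm_neg, hf.norm_eq_one, hf.norm_eq_one])
    (hf.areaForm_pos i) (neg_nonneg.2 hil) ?_
  rw [areaForm_smul_eq hf.orthonormal (hf.mem_span _) (hf.mem_span _) (hf.mem_span l), hzero,
    zero_smul, zero_add, neg_smul_neg]

section NoOpposite

variable [Fintype ι] {i : ι}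

theorem univ_eq [DecidableEq ι] (hf : IsPlaneFan e v next) (hopp : ∀ l, v l ≠ -v (next i)) :
    Finset.univ = {i, next i, next (next i)} := by
  ext l
  have := fun hi hn hn' => hopp l (hf.eq_neg_next (i := i) hi hn hn')
  simp only [Finset.mem_univ, Finset.mem_insert, Finset.mem_singleton]
  tauto

theorem mul_areaForm_add_eq_zero (hf : IsPlaneFan e v next) (hopp : ∀ l, v l ≠ -v (next i))
    {t : ι → ℝ} (ht : ∑ l, t l • v l = 0) :
    t (next i) * areaForm e (v i) (v (next i)) +
      t (next (next i)) * areaForm e (v i) (v (next (next i))) = 0 := by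
  classical
  have hne : i ≠ next (next i) := fun h => by
    have hpos := hf.areaForm_pos (next i)
    rw [← h, areaForm_swap] at hpos
    linarith [hf.areaForm_pos i]
  have hsum := areaForm_sum_smul_right Finset.univ e (v i) t v
  rw [ht, hf.univ_eq hopp, Finset.sum_insert (by simp [(hf.ne_next i).symm, hne]),
    Finset.sum_pair (hf.ne_next _).symm, areaForm_self, mul_zero, zero_add] at hsum
  simpa [areaForm] using hsum.symm

theorem relation_eq_of_next (hf : IsPlaneFan e v next) (hopp : ∀ l, v l ≠ -v (next i))
    {t t' : ι → ℝ} (ht : ∑ l, t l • v l = 0) (ht' : ∑ l, t' l • v l = 0)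
    (htt' : t (next i) = t' (next i)) (h0 : t (next i) ≠ 0) :
    t (next (next i)) = t' (next (next i)) := by
  have harea := hf.mul_areaForm_add_eq_zero hopp ht
  have hdiff : (t (next (next i)) - t' (next (next i))) *
      areaForm e (v i) (v (next (next i))) = 0 := by
    linear_combination harea - hf.mul_areaForm_add_eq_zero hopp ht' -
      areaForm e (v i) (v (next i)) * htt'
  refine sub_eq_zero.1 ((mul_eq_zero.1 hdiff).resolve_right fun h => ?_)
  rw [h, mul_zero, add_zero] at harea
  exact mul_ne_zero h0 (hf.areaForm_pos i).ne' harea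

theorem sum_smul_eq_zero_of_next (hf : IsPlaneFan e v next) (hopp : ∀ l, v l ≠ -v (next i))
    {x : ι → ℝ} (hx : x (next i) ≠ 0)
    (hrel : ∀ j, ∃ t : ι → ℝ, ∑ l, t l • v l = 0 ∧ t j = x j ∧ t (next j) = x (next j)) :
    ∑ l, x l • v l = 0 := by
  classical
  obtain ⟨t, ht, hti, htn⟩ := hrel i
  obtain ⟨t', ht', htn', htnn'⟩ := hrel (next i)
  have htnn := (hf.relation_eq_of_next hopp ht ht' (htn.trans htn'.symm) (htn ▸ hx)).trans htnn'
  have htx : t = x := funext fun l => by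
    have hl := hf.univ_eq hopp ▸ Finset.mem_univ l
    simp only [Finset.mem_insert, Finset.mem_singleton] at hl
    rcases hl with rfl | rfl | rfl <;> assumption
  rwa [htx] at ht

end NoOpposite

/-- Around a ray without an opposite one there are only three rays, and then a relation is
determined by two consecutive nonzero coefficients. -/
theorem sum_smul_eq_zero [Fintype ι] (hf : IsPlaneFan e v next) {x : ι → ℝ} (hx : ∀ i, x i ≠ 0)
    (hopp : ∀ i l, v l = -v i → x l = x i)
    (hrel : ∀ i, ∃ t : ι → ℝ, ∑ l, t l • v l = 0 ∧ t i = x i ∧ t (next i) = x (next i)) :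
    ∑ i, x i • v i = 0 := by
  by_cases hall : ∀ i, ∃ l, v l = -v i
  · exact sum_smul_eq_zero_of_forall_exists_eq_neg hf.injective hall hopp
  · push Not at hall
    obtain ⟨j, hj⟩ := hall
    obtain ⟨i, rfl⟩ := hf.next_injective.bijective_of_finite.surjective j
    exact hf.sum_smul_eq_zero_of_next hj (hx _) hrel

end IsPlaneFan

end PlaneFans

section CodimTwoFaces

open Set Filter Topology

variable {d : ℕ} {P : Set (EuclideanSpace ℝ (Fin d))} {𝒯 : Set (Set (EuclideanSpace ℝ (Fin d)))}
  {e : Fin 2 → EuclideanSpace ℝ (Fin d)} {A A' B B' C D D' F G : Set (EuclideanSpace ℝ (Fin d))}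
  {m m' n n' : EuclideanSpace ℝ (Fin d)}

/-- The hyperfaces of the tiling that contain `G`, over which the torsion around `G` is a sum. -/
abbrev hyperfacesAround (𝒯 : Set (Set (EuclideanSpace ℝ (Fin d))))
    (G : Set (EuclideanSpace ℝ (Fin d))) : Type :=
  {F : hyperfaces 𝒯 // G ⊆ F}

theorem mem_orthogonal_vectorSpan_of_subset (hGF : G ⊆ F) (hn : n ∈ (vectorSpan ℝ F)ᗮ) :
    n ∈ (vectorSpan ℝ G)ᗮ :=
  Submodule.orthogonal_le (vectorSpan_mono ℝ hGF) hn

theorem nonempty_of_mem_facesOfCodim {j : ℕ} (hF : F ∈ facesOfCodim 𝒯 j) : F.Nonempty :=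
  let ⟨_, _, hCF⟩ := hF.1
  hCF.1

theorem exists_mem_notMem_of_mem_facesOfCodim {j k : ℕ} (hjk : j < k) (hG : G ∈ facesOfCodim 𝒯 k)
    (hF : F ∈ facesOfCodim 𝒯 j) : ∃ x ∈ F, x ∉ G := by
  by_contra! hsub
  have hle := Submodule.finrank_mono (vectorSpan_mono ℝ (hsub : F ⊆ G))
  have hFd := hF.2
  have hGd := hG.2
  omega

theorem orthogonal_eq_span_of_mem_hyperfaces (hF : F ∈ hyperfaces 𝒯)
    (hn : n ∈ (vectorSpan ℝ F)ᗮ) (h0 : n ≠ 0) :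
    (vectorSpan ℝ F)ᗮ = Submodule.span ℝ {n} :=
  orthogonal_eq_span_singleton (by simpa using hF.2) hn h0

namespace IsTraversalNormal

theorem ne_zero (hn : IsTraversalNormal e G A n) : n ≠ 0 :=
  norm_ne_zero_iff.1 (hn.unit.trans_ne one_ne_zero)

theorem mem_span (hn : IsTraversalNormal e G A n) (he : IsTraversalFrame G e) (hGA : G ⊆ A) :
    n ∈ Submodule.span ℝ (range e) :=
  he.2 ▸ mem_orthogonal_vectorSpan_of_subset hGA hn.normal

theorem inner_sub_eq {w x y : EuclideanSpace ℝ (Fin d)} (hn : IsTraversalNormal e G A n)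
    (he : IsTraversalFrame G e) (hGA : G ⊆ A) (hw : w ∈ Submodule.span ℝ (range e)) (hx : x ∈ A)
    (hy : y ∈ A) : inner ℝ w (x - y) = areaForm e (x - y) n * areaForm e w n :=
  inner_eq_areaForm_mul he.1 (hn.mem_span he hGA) hn.unit hw
    (inner_sub_eq_zero_of_mem_orthogonal hn.normal hx hy)

theorem areaForm_sub_pos {x y : EuclideanSpace ℝ (Fin d)} (hn : IsTraversalNormal e G A n)
    (hy : y ∈ G) (hx : x ∈ A) (hxG : x ∉ G) : 0 < areaForm e (x - y) n :=
  hn.oriented y hy x ⟨hx, hxG⟩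

theorem areaForm_neg_of_inter_dirFace (hn : IsTraversalNormal e G A n) (he : IsTraversalFrame G e)
    (hG : G ∈ facesOfCodim 𝒯 2) (hA : A ∈ hyperfaces 𝒯) (hAD : A ⊆ D)
    (hm : m ∈ Submodule.span ℝ (range e)) (hinter : A ∩ dirFace D m = G) :
    areaForm e m n < 0 := by
  obtain ⟨y, hy⟩ := nonempty_of_mem_facesOfCodim hG
  obtain ⟨x, hx, hxG⟩ := exists_mem_notMem_of_mem_facesOfCodim one_lt_two hG hA
  have hyA : y ∈ A ∩ dirFace D m := hinter ▸ hy
  have hlt := inner_lt_of_notMem_dirFace hyA.2 (hAD hx) fun h => hxG (hinter ▸ ⟨hx, h⟩)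
  rw [← sub_neg, ← inner_sub_right, hn.inner_sub_eq he (hinter ▸ inter_subset_left) hm hx hyA.1]
    at hlt
  exact neg_of_mul_neg_right hlt (hn.areaForm_sub_pos hy hx hxG).le

end IsTraversalNormal

/-- The hyperfaces `A` and `B` around `G`, with the normals `n` and `n'` in the direction of
traversal `e`, are two facets of the cell `D`, which lies after `A` and before `B`: its outward
normals there are `-n` and `n'`. -/
structure IsConsecutive (𝒯 : Set (Set (EuclideanSpace ℝ (Fin d))))
    (e : Fin 2 → EuclideanSpace ℝ (Fin d)) (G A B D : Set (EuclideanSpace ℝ (Fin d)))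
    (n n' : EuclideanSpace ℝ (Fin d)) : Prop where
  frame : IsTraversalFrame G e
  mem_facesOfCodim : G ∈ facesOfCodim 𝒯 2
  mem : D ∈ 𝒯
  left_mem : A ∈ hyperfaces 𝒯
  right_mem : B ∈ hyperfaces 𝒯
  left_normal : IsTraversalNormal e G A n
  right_normal : IsTraversalNormal e G B n'
  left_eq : A = dirFace D (-n)
  right_eq : B = dirFace D n'
  inter_eq : A ∩ B = G

namespace IsConsecutive

variable (hc : IsConsecutive 𝒯 e G A B D n n')
include hc

theorem subset_left : G ⊆ A := hc.inter_eq ▸ inter_subset_left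

theorem subset_right : G ⊆ B := hc.inter_eq ▸ inter_subset_right

theorem left_subset : A ⊆ D := hc.left_eq ▸ dirFace_subset _ _

theorem right_subset : B ⊆ D := hc.right_eq ▸ dirFace_subset _ _

theorem left_mem_span : n ∈ Submodule.span ℝ (range e) :=
  hc.left_normal.mem_span hc.frame hc.subset_left

theorem right_mem_span : n' ∈ Submodule.span ℝ (range e) :=
  hc.right_normal.mem_span hc.frame hc.subset_right

theorem areaForm_pos : 0 < areaForm e n n' := by
  have hneg := hc.right_normal.areaForm_neg_of_inter_dirFace hc.frame hc.mem_facesOfCodim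
    hc.right_mem hc.right_subset (neg_mem hc.left_mem_span)
    (by rw [← hc.left_eq, inter_comm, hc.inter_eq])
  rwa [areaForm_neg_left, neg_lt_zero] at hneg

end IsConsecutive

namespace IsParallelohedronTiling

theorem convex_of_mem_facesOfCodim (h : IsParallelohedronTiling P 𝒯) {j : ℕ}
    (hF : F ∈ facesOfCodim 𝒯 j) : Convex ℝ F := by
  obtain ⟨⟨C, hC, hCF⟩, -⟩ := hF
  obtain ⟨-, m, rfl⟩ := isFace_iff.1 hCF
  exact convex_dirFace (h.convex hC) m

theorem isFace_of_subset (h : IsParallelohedronTiling P 𝒯) (hC : C ∈ 𝒯) (hD : D ∈ 𝒯)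
    (hG : IsFace C G) (hGD : G ⊆ D) : IsFace D G := by
  obtain ⟨⟨x, hx⟩, l, rfl⟩ := isFace_iff.1 hG
  obtain ⟨-, m, hm⟩ := isFace_iff.1 (h.face_to_face C hC D hD ⟨x, hx.1, hGD hx⟩).2
  have hface : dirFace C l = dirFace (dirFace D m) l := by
    rw [← hm]
    ext y
    exact ⟨fun hy => ⟨⟨hy.1, hGD hy⟩, fun z hz => hy.2 z hz.1⟩,
      fun hy => mem_dirFace_of_le hx hy.1.1 (hy.2 x ⟨hx.1, hGD hx⟩)⟩
  obtain ⟨W, hW, rfl⟩ := h.exists_finite_convexHull hD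
  obtain ⟨m', hm'⟩ := exists_dirFace_dirFace_eq hW (m := m) (l := l) (hface ▸ ⟨x, hx⟩)
  exact isFace_iff.2 ⟨⟨x, hx⟩, m', hface.trans hm'⟩

theorem ne_zero_of_dirFace_mem_hyperfaces (h : IsParallelohedronTiling P 𝒯) (hC : C ∈ 𝒯)
    (hm : dirFace C m ∈ hyperfaces 𝒯) : m ≠ 0 := by
  have hd : _ + 1 = d := hm.2
  refine ne_zero_of_finrank_dirFace (h.interior_nonempty hC) ?_
  rw [finrank_euclideanSpace_fin]
  omega

theorem exists_cell_dirFace (h : IsParallelohedronTiling P 𝒯) (hF : F ∈ hyperfaces 𝒯)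
    (hn : n ∈ (vectorSpan ℝ F)ᗮ) (hn0 : n ≠ 0) : ∃ D ∈ 𝒯, F = dirFace D n := by
  obtain ⟨⟨C, hC, hCF⟩, hd⟩ := id hF
  obtain ⟨hne, m, rfl⟩ := isFace_iff.1 hCF
  have hm := mem_orthogonal_vectorSpan_dirFace C m
  rw [orthogonal_eq_span_of_mem_hyperfaces hF hn hn0, Submodule.mem_span_singleton] at hm
  obtain ⟨a, rfl⟩ := hm
  rcases lt_trichotomy a 0 with ha | rfl | ha
  · obtain ⟨D, hD, -, hCD, hDm⟩ := h.exists_neighbour hC hne hd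
    refine ⟨D, hD, ?_⟩
    rw [← hCD, hDm, ← neg_smul, dirFace_smul D n (neg_pos.2 ha)]
  · exact absurd (zero_smul ℝ n) (h.ne_zero_of_dirFace_mem_hyperfaces hC hF)
  · exact ⟨C, hC, dirFace_smul C n ha⟩

theorem exists_dirFace_inter_eq (h : IsParallelohedronTiling P 𝒯) (hD : D ∈ 𝒯)
    (hA : dirFace D m ∈ hyperfaces 𝒯) (hG : G ∈ facesOfCodim 𝒯 2) (hGA : G ⊆ dirFace D m) :
    ∃ m', dirFace D m' ∈ hyperfaces 𝒯 ∧ dirFace D m ∩ dirFace D m' = G := by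
  obtain ⟨⟨C, hC, hCG⟩, hGd⟩ := hG
  have hGD := hGA.trans (dirFace_subset D m)
  obtain ⟨⟨x, hx⟩, l, rfl⟩ := isFace_iff.1 (h.isFace_of_subset hC hD hCG hGD)
  have hl : dirFace (dirFace D m) l = dirFace D l := by
    ext y
    exact ⟨fun hy => mem_dirFace_of_le hx hy.1.1 (hy.2 x (hGA hx)),
      fun hy => ⟨hGA hy, fun z hz => hy.2 z hz.1⟩⟩
  obtain ⟨W, hW, rfl⟩ := h.exists_finite_convexHull hD
  obtain ⟨m', hm', hinter⟩ := exists_dirFace_inter_dirFace_eq hW (h.interior_nonempty hD)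
    (m := m) (l := l) (by simpa using hA.2) (by rwa [hl, finrank_euclideanSpace_fin]) (hl ▸ ⟨x, hx⟩)
  rw [hl] at hinter
  rw [finrank_euclideanSpace_fin] at hm'
  have hx' : x ∈ dirFace (convexHull ℝ W) m' := (hinter ▸ hx : x ∈ dirFace _ m ∩ dirFace _ m').2
  exact ⟨m', ⟨⟨_, hD, isFace_iff.2 ⟨⟨x, hx'⟩, m', rfl⟩⟩, hm'⟩, hinter⟩

theorem exists_isConsecutive (h : IsParallelohedronTiling P 𝒯) (hG : G ∈ facesOfCodim 𝒯 2)
    (he : IsTraversalFrame G e) {ν : hyperfacesAround 𝒯 G → EuclideanSpace ℝ (Fin d)}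
    (hν : ∀ A, IsTraversalNormal e G A.1 (ν A)) (A : hyperfacesAround 𝒯 G) :
    ∃ B D, IsConsecutive 𝒯 e G A.1 B.1 D (ν A) (ν B) := by
  obtain ⟨⟨A, hA⟩, hGA⟩ := A
  set n := ν ⟨⟨A, hA⟩, hGA⟩
  have hn : IsTraversalNormal e G A n := hν ⟨⟨A, hA⟩, hGA⟩
  obtain ⟨D, hD, hAD⟩ := h.exists_cell_dirFace hA (neg_mem hn.normal) (neg_ne_zero.2 hn.ne_zero)
  obtain ⟨m, hB, hinter⟩ := h.exists_dirFace_inter_eq hD (hAD ▸ hA) hG (hAD ▸ hGA)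
  rw [← hAD] at hinter
  have hGB : G ⊆ dirFace D m := hinter ▸ inter_subset_right
  set n' := ν ⟨⟨_, hB⟩, hGB⟩
  have hn' : IsTraversalNormal e G (dirFace D m) n' := hν ⟨⟨_, hB⟩, hGB⟩
  obtain ⟨a, ha⟩ := Submodule.mem_span_singleton.1
    (orthogonal_eq_span_of_mem_hyperfaces hB hn'.normal hn'.ne_zero ▸
      mem_orthogonal_vectorSpan_dirFace D m)
  have hpos := hn'.areaForm_neg_of_inter_dirFace he hG hB (dirFace_subset _ _)
    (neg_mem (hn.mem_span he hGA)) (by rw [inter_comm, ← hAD, hinter])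
  have hneg := hn.areaForm_neg_of_inter_dirFace he hG hA (hAD ▸ dirFace_subset _ _)
    (ha ▸ Submodule.smul_mem _ a (hn'.mem_span he hGB)) hinter
  rw [areaForm_neg_left, areaForm_swap, neg_neg] at hpos
  rw [← ha, areaForm_smul_left] at hneg
  have ha0 : 0 < a := pos_of_mul_neg_left hneg hpos.le
  exact ⟨⟨⟨_, hB⟩, hGB⟩, D, he, hG, hD, hA, hB, hn, hn', hAD,
    (congrArg _ ha.symm).trans (dirFace_smul D n' ha0), hinter⟩

theorem finrank_dirFace (h : IsParallelohedronTiling P 𝒯) (hC : C ∈ 𝒯) (hD : D ∈ 𝒯)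
    (m : EuclideanSpace ℝ (Fin d)) :
    Module.finrank ℝ (vectorSpan ℝ (dirFace C m)) =
      Module.finrank ℝ (vectorSpan ℝ (dirFace D m)) := by
  obtain ⟨t, rfl⟩ := h.exists_vadd_eq hC hD
  rw [dirFace_vadd, vectorSpan_vadd]

/-- All cells being translates of one another, `m` would be an outward facet normal of `D`; but
strictly between its outward normals at `A` and `B` the face of `D` is `G`. -/
theorem smul_ne_of_isConsecutive (h : IsParallelohedronTiling P 𝒯)
    (hc : IsConsecutive 𝒯 e G A B D n n') (hF : F ∈ hyperfaces 𝒯) (hm : m ∈ (vectorSpan ℝ F)ᗮ)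
    (hm0 : m ≠ 0) {c a b : ℝ} (hc0 : 0 < c) (ha : 0 < a) (hb : 0 < b) :
    c • m ≠ a • -n + b • n' := by
  intro heq
  obtain ⟨D', hD', rfl⟩ := h.exists_cell_dirFace hF hm hm0
  have hinter : dirFace D (a • -n) ∩ dirFace D (b • n') = G := by
    rw [dirFace_smul _ _ ha, dirFace_smul _ _ hb, ← hc.left_eq, ← hc.right_eq, hc.inter_eq]
  have hDm : dirFace D m = G := by
    rw [← dirFace_smul D m hc0, heq, ← hinter]
    exact dirFace_add_eq_inter (hinter ▸ nonempty_of_mem_facesOfCodim hc.mem_facesOfCodim)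
  have hdim := h.finrank_dirFace hc.mem hD' m
  rw [hDm] at hdim
  have hGd := hc.mem_facesOfCodim.2
  have hFd := hF.2
  omega

theorem eventually_add_smul_mem_interior_of_isConsecutive (h : IsParallelohedronTiling P 𝒯)
    (hc : IsConsecutive 𝒯 e G A B D n n') {w y : EuclideanSpace ℝ (Fin d)}
    (hy : y ∈ intrinsicInterior ℝ G) (hw : 0 < inner ℝ n w) (hw' : inner ℝ n' w < 0) :
    ∀ᶠ ε in 𝓝[>] (0 : ℝ), y + ε • w ∈ interior D := by
  have hyG := intrinsicInterior_subset hy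
  obtain ⟨x, hx, hxG⟩ := exists_mem_notMem_of_mem_facesOfCodim one_lt_two hc.mem_facesOfCodim
    hc.left_mem
  obtain ⟨x', hx', hxG'⟩ := exists_mem_notMem_of_mem_facesOfCodim one_lt_two hc.mem_facesOfCodim
    hc.right_mem
  have harea := hc.left_normal.areaForm_sub_pos hyG hx hxG
  have harea' := hc.right_normal.areaForm_sub_pos hyG hx' hxG'
  refine eventually_add_smul_mem_interior (m := -n) (m' := n') (eventually_add_mem_of_inner_neg
    (h.convex hc.mem) (hc.subset_left.trans hc.left_subset) hy (fun g hg hg' => ?_)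
    (u := x - y) (v := x' - y) ?_ ?_ ?_ ?_ ?_ ?_) ?_ hw'
  · rw [← (vectorSpan ℝ G).orthogonal_orthogonal, ← hc.frame.2]
    exact mem_orthogonal_span_range hc.frame.1 hc.left_mem_span hc.right_mem_span
      hc.areaForm_pos.ne' (by simpa using hg) hg'
  · rw [add_sub_cancel]
    exact hc.left_subset hx
  · rw [add_sub_cancel]
    exact hc.right_subset hx'
  · rw [inner_neg_left, inner_sub_eq_zero_of_mem_orthogonal hc.left_normal.normal hx
      (hc.subset_left hyG), neg_zero]
  · rw [hc.left_normal.inner_sub_eq hc.frame hc.subset_left hc.right_mem_span hx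
      (hc.subset_left hyG), areaForm_swap e n' n]
    exact mul_neg_of_pos_of_neg harea (neg_neg_of_pos hc.areaForm_pos)
  · rw [inner_neg_left, hc.right_normal.inner_sub_eq hc.frame hc.subset_right hc.left_mem_span hx'
      (hc.subset_right hyG)]
    exact neg_neg_of_pos (mul_pos harea' hc.areaForm_pos)
  · exact inner_sub_eq_zero_of_mem_orthogonal hc.right_normal.normal hx' (hc.subset_right hyG)
  · rwa [inner_neg_left, neg_lt_zero]

theorem eq_of_isConsecutive (h : IsParallelohedronTiling P 𝒯)
    (hc : IsConsecutive 𝒯 e G A B D n n') (hc' : IsConsecutive 𝒯 e G A' B' D' n m') : A = A' := by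
  obtain ⟨y, hy⟩ := (nonempty_of_mem_facesOfCodim hc.mem_facesOfCodim).intrinsicInterior
    (h.convex_of_mem_facesOfCodim hc.mem_facesOfCodim)
  have hyA := hc.subset_left (intrinsicInterior_subset hy)
  obtain ⟨x, hx, hxG⟩ := exists_mem_notMem_of_mem_facesOfCodim one_lt_two hc.mem_facesOfCodim
    hc.left_mem
  have harea := hc.left_normal.areaForm_sub_pos (intrinsicInterior_subset hy) hx hxG
  have heventually {m : EuclideanSpace ℝ (Fin d)} (hm : m ∈ Submodule.span ℝ (range e))
      (hpos : 0 < areaForm e n m) :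
      ∀ᶠ δ in 𝓝[>] (0 : ℝ), inner ℝ m (x - y + δ • n) < 0 := by
    have hcont : ContinuousAt (fun δ : ℝ => inner ℝ m (x - y + δ • n)) 0 := by fun_prop
    refine (hcont.eventually_lt continuousAt_const ?_).filter_mono nhdsWithin_le_nhds
    rw [zero_smul, add_zero, hc.left_normal.inner_sub_eq hc.frame hc.subset_left hm hx hyA,
      areaForm_swap e m n]
    exact mul_neg_of_pos_of_neg harea (neg_neg_of_pos hpos)
  -- The direction `x - y + δ • n` lies after `A` and before both `B` and `B'`.
  obtain ⟨δ, ⟨hB, hB'⟩, hδ⟩ := (((heventually hc.right_mem_span hc.areaForm_pos).and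
    (heventually hc'.right_mem_span hc'.areaForm_pos)).and self_mem_nhdsWithin).exists
  have hA : 0 < inner ℝ n (x - y + δ • n) := by
    rw [inner_add_right, inner_sub_eq_zero_of_mem_orthogonal hc.left_normal.normal hx hyA,
      zero_add, inner_smul_right]
    exact mul_pos hδ (real_inner_self_pos.2 hc.left_normal.ne_zero)
  obtain ⟨ε, hεD, hεD'⟩ := ((h.eventually_add_smul_mem_interior_of_isConsecutive hc hy hA hB).and
    (h.eventually_add_smul_mem_interior_of_isConsecutive hc' hy hA hB')).exists
  have hDD' : D = D' := by
    by_contra hne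
    exact disjoint_left.1 (h.disjoint_interiors D hc.mem D' hc'.mem hne) hεD hεD'
  rw [hc.left_eq, hc'.left_eq, hDD']

/-- Otherwise `F` would issue from `G` into the interior of `D`. -/
theorem areaForm_nonpos_of_areaForm_pos (h : IsParallelohedronTiling P 𝒯)
    (hc : IsConsecutive 𝒯 e G A B D n n') (hF : F ∈ hyperfaces 𝒯) (hGF : G ⊆ F)
    (hm : IsTraversalNormal e G F m) (hpos : 0 < areaForm e n m) : areaForm e m n' ≤ 0 := by
  by_contra! hpos'
  obtain ⟨y, hy⟩ := (nonempty_of_mem_facesOfCodim hc.mem_facesOfCodim).intrinsicInterior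
    (h.convex_of_mem_facesOfCodim hc.mem_facesOfCodim)
  have hyF := hGF (intrinsicInterior_subset hy)
  obtain ⟨x, hx, hxG⟩ := exists_mem_notMem_of_mem_facesOfCodim one_lt_two hc.mem_facesOfCodim hF
  have harea := hm.areaForm_sub_pos (intrinsicInterior_subset hy) hx hxG
  have hleft : 0 < inner ℝ n (x - y) := by
    rw [hm.inner_sub_eq hc.frame hGF hc.left_mem_span hx hyF]
    exact mul_pos harea hpos
  have hright : inner ℝ n' (x - y) < 0 := by
    rw [hm.inner_sub_eq hc.frame hGF hc.right_mem_span hx hyF, areaForm_swap e n' m]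
    exact mul_neg_of_pos_of_neg harea (neg_neg_of_pos hpos')
  obtain ⟨ε, hεD, hε⟩ :=
    ((h.eventually_add_smul_mem_interior_of_isConsecutive hc hy hleft hright).and
      (Ioo_mem_nhdsGT one_pos)).exists
  have hεF : y + ε • (x - y) ∈ F :=
    (h.convex_of_mem_facesOfCodim hF).add_smul_sub_mem hyF hx (Ioo_subset_Icc_self hε)
  obtain ⟨D', hD', rfl⟩ := h.exists_cell_dirFace hF hm.normal hm.ne_zero
  rcases eq_or_ne D D' with rfl | hne
  · exact notMem_interior_of_mem_dirFace hm.ne_zero hεF hεD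
  · exact disjoint_left.1 (h.disjoint_interior_cell hc.mem hD' hne) hεD (dirFace_subset D' m hεF)

theorem eq_or_eq_or_areaForm_nonpos (h : IsParallelohedronTiling P 𝒯)
    (hc : IsConsecutive 𝒯 e G A B D n n') (hF : F ∈ hyperfaces 𝒯) (hGF : G ⊆ F)
    (hm : IsTraversalNormal e G F m) :
    m = n ∨ m = n' ∨ areaForm e n m ≤ 0 ∧ areaForm e m n' ≤ 0 := by
  have hpos := hc.areaForm_pos
  have hexpand := areaForm_smul_eq hc.frame.1 hc.left_mem_span hc.right_mem_span
    (hm.mem_span hc.frame hGF)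
  rcases lt_trichotomy (areaForm e m n') 0 with hright | hright | hright
  · refine Or.inr (Or.inr ⟨not_lt.1 fun hleft => ?_, hright.le⟩)
    refine h.smul_ne_of_isConsecutive hc hF hm.normal hm.ne_zero hpos (neg_pos.2 hright) hleft ?_
    rw [hexpand, neg_smul_neg]
  · refine Or.inr ((le_or_gt (areaForm e n m) 0).symm.imp (fun hleft => ?_) (⟨·, hright.le⟩))
    rw [hright, zero_smul, zero_add] at hexpand
    exact eq_of_smul_eq_smul_of_norm_eq (hm.unit.trans hc.right_normal.unit.symm) hpos hleft.le
      hexpand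
  · refine Or.inl ?_
    rcases lt_trichotomy (areaForm e n m) 0 with hleft | hleft | hleft
    · refine absurd ?_ (h.smul_ne_of_isConsecutive hc hF (neg_mem hm.normal)
        (neg_ne_zero.2 hm.ne_zero) hpos hright (neg_pos.2 hleft))
      rw [smul_neg, hexpand, neg_add, smul_neg, neg_smul]
    · rw [hleft, zero_smul, add_zero] at hexpand
      exact eq_of_smul_eq_smul_of_norm_eq (hm.unit.trans hc.left_normal.unit.symm) hpos hright.le
        hexpand
    · exact absurd hright (h.areaForm_nonpos_of_areaForm_pos hc hF hGF hm hleft).not_gt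

theorem exists_isPlaneFan (h : IsParallelohedronTiling P 𝒯) (hG : G ∈ facesOfCodim 𝒯 2)
    (he : IsTraversalFrame G e) {ν : hyperfacesAround 𝒯 G → EuclideanSpace ℝ (Fin d)}
    (hν : ∀ A, IsTraversalNormal e G A.1 (ν A)) :
    ∃ next, IsPlaneFan e ν next ∧
      ∀ A, ∃ D, IsConsecutive 𝒯 e G A.1 (next A).1 D (ν A) (ν (next A)) := by
  choose next D hc using h.exists_isConsecutive hG he hν
  have hinj : Function.Injective ν := fun A B hAB =>
    Subtype.ext (Subtype.ext (h.eq_of_isConsecutive (hc A) (hAB ▸ hc B)))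
  refine ⟨next, ⟨he.1, fun A => (hν A).mem_span he A.2, fun A => (hν A).unit, hinj,
    fun A => (hc A).areaForm_pos, fun A B hBA hBnext => ?_⟩, fun A => ⟨D A, hc A⟩⟩
  rcases h.eq_or_eq_or_areaForm_nonpos (hc A) B.1.2 B.2 (hν B) with heq | heq | hle
  · exact absurd (hinj heq) hBA
  · exact absurd (hinj heq) hBnext
  · exact hle

end IsParallelohedronTiling

end CodimTwoFaces

section Torsion

variable {d : ℕ} {𝒯 : Set (Set (EuclideanSpace ℝ (Fin d)))}
  {e e' : Fin 2 → EuclideanSpace ℝ (Fin d)} {A G : Set (EuclideanSpace ℝ (Fin d))}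
  {n n' τ : EuclideanSpace ℝ (Fin d)} {s t : hyperfaces 𝒯 → ℝ}

theorem IsTraversalFrame.areaForm_eq_mul (he : IsTraversalFrame G e) (he' : IsTraversalFrame G e')
    (a b : EuclideanSpace ℝ (Fin d)) :
    areaForm e a b = areaForm e' (e 0) (e 1) * areaForm e' a b := by
  have hmem (i : Fin 2) : e i ∈ Submodule.span ℝ (Set.range e') :=
    he'.2 ▸ he.2 ▸ Submodule.subset_span ⟨i, rfl⟩
  simp only [areaForm, inner_eq_of_mem_span_range he'.1 (hmem _)]
  ring

theorem IsTraversalNormal.eq_sign_smul (hG : G ∈ facesOfCodim 𝒯 2) (hA : A ∈ hyperfaces 𝒯)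
    (he : IsTraversalFrame G e) (he' : IsTraversalFrame G e') (hn : IsTraversalNormal e G A n)
    (hn' : IsTraversalNormal e' G A n') :
    n' = Real.sign (areaForm e' (e 0) (e 1)) • n := by
  obtain ⟨y, hy⟩ := nonempty_of_mem_facesOfCodim hG
  obtain ⟨x, hx, hxG⟩ := exists_mem_notMem_of_mem_facesOfCodim one_lt_two hG hA
  obtain ⟨c, rfl⟩ := Submodule.mem_span_singleton.1
    (orthogonal_eq_span_of_mem_hyperfaces hA hn.normal hn.ne_zero ▸ hn'.normal)
  have hc : |c| = 1 := by simpa [norm_smul, hn.unit] using hn'.unit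
  have hpos := hn.areaForm_sub_pos hy hx hxG
  have hpos' := hn'.areaForm_sub_pos hy hx hxG
  rw [he.areaForm_eq_mul he'] at hpos
  rw [areaForm_swap, areaForm_smul_left, ← mul_neg, ← areaForm_swap] at hpos'
  congr 1
  rcases pos_and_pos_or_neg_and_neg_of_mul_pos hpos with ⟨hsign, harea⟩ | ⟨hsign, harea⟩
  · rw [Real.sign_of_pos hsign, ← hc, abs_of_pos (pos_of_mul_pos_left hpos' harea.le)]
  · rw [Real.sign_of_neg hsign, ← hc, abs_of_neg (neg_of_mul_pos_left hpos' harea.le), neg_neg]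

theorem IsTorsion.exists_traversalNormal (hs : IsTorsion 𝒯 s G τ) :
    Finite (hyperfacesAround 𝒯 G) ∧ ∃ e, IsTraversalFrame G e ∧
      ∃ ν : hyperfacesAround 𝒯 G → EuclideanSpace ℝ (Fin d),
        ∀ A, IsTraversalNormal e G A.1 (ν A) := by
  obtain ⟨e, he, k, F, n, hn, -⟩ := hs
  exact ⟨Finite.of_equiv _ F, e, he, n ∘ F.symm,
    fun A => by simpa only [Function.comp_apply, Equiv.apply_symm_apply] using hn (F.symm A)⟩

theorem isTorsion_zero_iff [Fintype (hyperfacesAround 𝒯 G)] (hG : G ∈ facesOfCodim 𝒯 2)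
    (he : IsTraversalFrame G e) {ν : hyperfacesAround 𝒯 G → EuclideanSpace ℝ (Fin d)}
    (hν : ∀ A, IsTraversalNormal e G A.1 (ν A)) :
    IsTorsion 𝒯 s G 0 ↔ ∑ A : hyperfacesAround 𝒯 G, s A.1 • ν A = 0 := by
  refine ⟨?_, fun h0 => ?_⟩
  · rintro ⟨e', he', k, F, n, hn, h0⟩
    have hsmul (i : Fin k) : ν (F i) = Real.sign (areaForm e (e' 0) (e' 1)) • n i :=
      (hn i).eq_sign_smul hG (F i).1.2 he' he (hν (F i))
    rw [← F.sum_comp]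
    simp only [hsmul, smul_comm (s _), ← Finset.smul_sum, ← h0, smul_zero]
  · let F := (Fintype.equivFin (hyperfacesAround 𝒯 G)).symm
    exact ⟨e, he, _, F, ν ∘ F, fun i => hν (F i),
      h0.symm.trans (F.sum_comp fun A => s A.1 • ν A).symm⟩

theorem IsCanonicalScaling.add (hs : IsCanonicalScaling 𝒯 s) (ht : IsCanonicalScaling 𝒯 t) :
    IsCanonicalScaling 𝒯 (s + t) := by
  refine ⟨fun F => add_pos (hs.1 F) (ht.1 F), fun G hG => ?_⟩
  obtain ⟨_, e, he, ν, hν⟩ := (hs.2 G hG).exists_traversalNormal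
  have := Fintype.ofFinite (hyperfacesAround 𝒯 G)
  have hs0 := (isTorsion_zero_iff hG he hν).1 (hs.2 G hG)
  have ht0 := (isTorsion_zero_iff hG he hν).1 (ht.2 G hG)
  refine (isTorsion_zero_iff hG he hν).2 ?_
  simp only [Pi.add_apply, add_smul, Finset.sum_add_distrib, hs0, ht0, add_zero]

end Torsion

section Symmetries

open Set

variable {d : ℕ} {𝒯 : Set (Set (EuclideanSpace ℝ (Fin d)))}
  {e : Fin 2 → EuclideanSpace ℝ (Fin d)} {A G : Set (EuclideanSpace ℝ (Fin d))}
  {n : EuclideanSpace ℝ (Fin d)} {s : hyperfaces 𝒯 → ℝ}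
  {φ : EuclideanSpace ℝ (Fin d) ≃ᵃⁱ[ℝ] EuclideanSpace ℝ (Fin d)}

theorem inner_map_sub_map (m x y : EuclideanSpace ℝ (Fin d)) :
    inner ℝ (φ.linearIsometryEquiv m) (φ x - φ y) = inner ℝ m (x - y) := by
  rw [← vsub_eq_sub, ← φ.map_vsub, LinearIsometryEquiv.inner_map_map, vsub_eq_sub]

theorem image_dirFace (C : Set (EuclideanSpace ℝ (Fin d))) (m : EuclideanSpace ℝ (Fin d)) :
    φ '' dirFace C m = dirFace (φ '' C) (φ.linearIsometryEquiv m) := by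
  have hle (x y : EuclideanSpace ℝ (Fin d)) : inner ℝ (φ.linearIsometryEquiv m) (φ y) ≤
      inner ℝ (φ.linearIsometryEquiv m) (φ x) ↔ inner ℝ m y ≤ inner ℝ m x := by
    rw [← sub_nonneg, ← inner_sub_right, inner_map_sub_map, inner_sub_right, sub_nonneg]
  ext z
  constructor
  · rintro ⟨x, ⟨hx, hmax⟩, rfl⟩
    exact ⟨mem_image_of_mem _ hx, forall_mem_image.2 fun y hy => (hle x y).2 (hmax y hy)⟩
  · rintro ⟨⟨x, hx, rfl⟩, hmax⟩
    exact ⟨x, ⟨hx, fun y hy => (hle x y).1 (hmax _ (mem_image_of_mem _ hy))⟩, rfl⟩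

theorem vectorSpan_image (A : Set (EuclideanSpace ℝ (Fin d))) :
    vectorSpan ℝ (φ '' A) = (vectorSpan ℝ A).map (φ.linearIsometryEquiv.toLinearEquiv :
      EuclideanSpace ℝ (Fin d) →ₗ[ℝ] EuclideanSpace ℝ (Fin d)) :=
  (φ.toAffineEquiv.toAffineMap.map_vectorSpan).symm

theorem orthogonal_vectorSpan_image (A : Set (EuclideanSpace ℝ (Fin d))) :
    (vectorSpan ℝ (φ '' A))ᗮ = (vectorSpan ℝ A)ᗮ.map (φ.linearIsometryEquiv.toLinearEquiv :
      EuclideanSpace ℝ (Fin d) →ₗ[ℝ] EuclideanSpace ℝ (Fin d)) := by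
  rw [vectorSpan_image]
  exact (Submodule.map_orthogonal_equiv _ φ.linearIsometryEquiv).symm

theorem IsTraversalFrame.image (he : IsTraversalFrame G e) :
    IsTraversalFrame (φ '' G) (φ.linearIsometryEquiv ∘ e) := by
  refine ⟨he.1.comp_linearIsometryEquiv _, ?_⟩
  rw [orthogonal_vectorSpan_image, ← he.2, Submodule.map_span, range_comp]
  rfl

theorem IsTraversalNormal.image (hn : IsTraversalNormal e G A n) :
    IsTraversalNormal (φ.linearIsometryEquiv ∘ e) (φ '' G) (φ '' A)
      (φ.linearIsometryEquiv n) where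
  unit := by rw [LinearIsometryEquiv.norm_map, hn.unit]
  normal := by
    rw [orthogonal_vectorSpan_image]
    exact Submodule.mem_map_of_mem hn.normal
  oriented := by
    rintro _ ⟨y, hy, rfl⟩ _ ⟨⟨x, hx, rfl⟩, hxG⟩
    simp only [Function.comp_apply, inner_map_sub_map, LinearIsometryEquiv.inner_map_map]
    exact hn.oriented y hy x ⟨hx, fun hxG' => hxG (mem_image_of_mem _ hxG')⟩

/-- The isometry `φ` maps the tiling onto itself. -/
def IsSymmetry (𝒯 : Set (Set (EuclideanSpace ℝ (Fin d))))
    (φ : EuclideanSpace ℝ (Fin d) ≃ᵃⁱ[ℝ] EuclideanSpace ℝ (Fin d)) : Prop :=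
  ∀ C, φ '' C ∈ 𝒯 ↔ C ∈ 𝒯

namespace IsSymmetry

theorem symm (hφ : IsSymmetry 𝒯 φ) : IsSymmetry 𝒯 φ.symm := fun C => by
  rw [← hφ, image_image]
  simp only [AffineIsometryEquiv.apply_symm_apply, image_id']

theorem image_mem_facesOfCodim (hφ : IsSymmetry 𝒯 φ) {j : ℕ} (hA : A ∈ facesOfCodim 𝒯 j) :
    φ '' A ∈ facesOfCodim 𝒯 j := by
  obtain ⟨⟨C, hC, hCA⟩, hd⟩ := hA
  obtain ⟨hne, m, rfl⟩ := isFace_iff.1 hCA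
  refine ⟨⟨φ '' C, (hφ C).2 hC, isFace_iff.2 ⟨hne.image _, _, image_dirFace C m⟩⟩, ?_⟩
  rw [vectorSpan_image, LinearEquiv.finrank_map_eq]
  exact hd

/-- The permutation of the hyperfaces by a symmetry of the tiling. -/
def hyperfaceEquiv (hφ : IsSymmetry 𝒯 φ) : hyperfaces 𝒯 ≃ hyperfaces 𝒯 where
  toFun F := ⟨φ '' F.1, hφ.image_mem_facesOfCodim F.2⟩
  invFun F := ⟨φ.symm '' F.1, hφ.symm.image_mem_facesOfCodim F.2⟩
  left_inv F := Subtype.ext (φ.toEquiv.symm_image_image F.1)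
  right_inv F := Subtype.ext (φ.toEquiv.image_symm_image F.1)

theorem isCanonicalScaling_comp (hφ : IsSymmetry 𝒯 φ) (hs : IsCanonicalScaling 𝒯 s) :
    IsCanonicalScaling 𝒯 (s ∘ hφ.hyperfaceEquiv) := by
  refine ⟨fun F => hs.1 _, fun G hG => ?_⟩
  obtain ⟨e, he, k, F, n, hn, h0⟩ := hs.2 _ (hφ.image_mem_facesOfCodim hG)
  have hsymm (A : Set (EuclideanSpace ℝ (Fin d))) : φ.symm '' (φ '' A) = A :=
    φ.toEquiv.symm_image_image A
  have hsubset (A : hyperfaces 𝒯) : φ '' G ⊆ A.1 ↔ G ⊆ (hφ.hyperfaceEquiv.symm A).1 := by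
    rw [← image_subset_image_iff φ.symm.injective, hsymm]
    rfl
  refine ⟨φ.symm.linearIsometryEquiv ∘ e, hsymm G ▸ he.image, k,
    F.trans (hφ.hyperfaceEquiv.symm.subtypeEquiv hsubset),
    fun i => φ.symm.linearIsometryEquiv (n i), fun i => ?_, ?_⟩
  · have hi := (hn i).image (φ := φ.symm)
    rwa [hsymm] at hi
  · simp only [Function.comp_apply, Equiv.trans_apply, Equiv.subtypeEquiv_apply,
      Equiv.apply_symm_apply, ← map_smul, ← map_sum]
    rw [← h0, map_zero]

end IsSymmetry

theorem isSymmetry_constVAdd {v : EuclideanSpace ℝ (Fin d)}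
    (hv : v ∈ AddAction.stabilizer (EuclideanSpace ℝ (Fin d)) 𝒯) :
    IsSymmetry 𝒯 (AffineIsometryEquiv.constVAdd ℝ (EuclideanSpace ℝ (Fin d)) v) :=
  AddAction.mem_stabilizer_set.1 hv

theorem image_constVSub (w : EuclideanSpace ℝ (Fin d)) (A : Set (EuclideanSpace ℝ (Fin d))) :
    AffineIsometryEquiv.constVSub ℝ w '' A = w +ᵥ -A := by
  rw [← image_neg_eq_neg, ← image_vadd, image_image]
  simp only [AffineIsometryEquiv.coe_constVSub, vsub_eq_sub, vadd_eq_add, sub_eq_add_neg]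

theorem isSymmetry_constVSub {w : EuclideanSpace ℝ (Fin d)} (hw : ∀ C ∈ 𝒯, w +ᵥ -C ∈ 𝒯) :
    IsSymmetry 𝒯 (AffineIsometryEquiv.constVSub ℝ w) := by
  intro C
  rw [image_constVSub]
  refine ⟨fun hC => ?_, hw C⟩
  simpa only [neg_vadd_set, neg_neg, vadd_vadd, add_neg_cancel, zero_vadd] using hw _ hC

end Symmetries

section ParallelHyperfaces

open Set

variable {d : ℕ} {P : Set (EuclideanSpace ℝ (Fin d))} {𝒯 : Set (Set (EuclideanSpace ℝ (Fin d)))}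
  {A B C D : Set (EuclideanSpace ℝ (Fin d))} {m m' n w : EuclideanSpace ℝ (Fin d)}
  {s : hyperfaces 𝒯 → ℝ}

theorem vectorSpan_eq_of_mem_orthogonal (hA : A ∈ hyperfaces 𝒯) (hB : B ∈ hyperfaces 𝒯)
    (hn0 : n ≠ 0) (hnA : n ∈ (vectorSpan ℝ A)ᗮ) (hnB : n ∈ (vectorSpan ℝ B)ᗮ) :
    vectorSpan ℝ A = vectorSpan ℝ B := by
  rw [← (vectorSpan ℝ A).orthogonal_orthogonal, ← (vectorSpan ℝ B).orthogonal_orthogonal,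
    orthogonal_eq_span_of_mem_hyperfaces hA hnA hn0,
    orthogonal_eq_span_of_mem_hyperfaces hB hnB hn0]

theorem IsCanonicalScaling.exists_comp_reflection_eq (hs : IsCanonicalScaling 𝒯 s)
    (hw : ∀ C ∈ 𝒯, w +ᵥ -C ∈ 𝒯) :
    ∃ t, IsCanonicalScaling 𝒯 t ∧
      ∀ F F' : hyperfaces 𝒯, (F' : Set (EuclideanSpace ℝ (Fin d))) = w +ᵥ -F.1 → t F' = t F := by
  have hφ := isSymmetry_constVSub hw
  refine ⟨s + s ∘ hφ.hyperfaceEquiv, hs.add (hφ.isCanonicalScaling_comp hs), fun F F' hFF' => ?_⟩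
  have hF : hφ.hyperfaceEquiv F = F' := Subtype.ext ((image_constVSub w F.1).trans hFF'.symm)
  have hF' : hφ.hyperfaceEquiv F' = F := by
    refine Subtype.ext ((image_constVSub w F'.1).trans ?_)
    rw [hFF', neg_vadd_set, neg_neg, vadd_vadd, add_neg_cancel, zero_vadd]
  rw [Pi.add_apply, Pi.add_apply, Function.comp_apply, Function.comp_apply, hF, hF', add_comm]

namespace IsParallelohedronTiling

theorem dirFace_eq_or_eq_reflection (h : IsParallelohedronTiling P 𝒯) (hC : C ∈ 𝒯)
    (hw : w +ᵥ -C = C) (hm : dirFace C m ∈ hyperfaces 𝒯) (hm' : dirFace C m' ∈ hyperfaces 𝒯)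
    (hparallel : vectorSpan ℝ (dirFace C m) = vectorSpan ℝ (dirFace C m')) :
    dirFace C m' = dirFace C m ∨ dirFace C m' = w +ᵥ -dirFace C m := by
  have hm0 := h.ne_zero_of_dirFace_mem_hyperfaces hC hm
  obtain ⟨a, rfl⟩ := Submodule.mem_span_singleton.1
    (orthogonal_eq_span_of_mem_hyperfaces hm (mem_orthogonal_vectorSpan_dirFace C m) hm0 ▸
      hparallel ▸ mem_orthogonal_vectorSpan_dirFace C m')
  rcases lt_trichotomy a 0 with ha | rfl | ha
  · right
    rw [← neg_smul_neg, dirFace_smul C _ (neg_pos.2 ha)]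
    conv_lhs => rw [← hw]
    rw [dirFace_vadd, dirFace_neg, neg_neg]
  · exact absurd (zero_smul ℝ m) (h.ne_zero_of_dirFace_mem_hyperfaces hC hm')
  · exact Or.inl (dirFace_smul C m ha)

theorem exists_dirFace_mem_hyperfaces_vectorSpan_eq (h : IsParallelohedronTiling P 𝒯)
    (hC : C ∈ 𝒯) (hA : A ∈ hyperfaces 𝒯) :
    ∃ m, dirFace C m ∈ hyperfaces 𝒯 ∧ vectorSpan ℝ A = vectorSpan ℝ (dirFace C m) := by
  obtain ⟨⟨D, hD, hDA⟩, hd⟩ := hA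
  obtain ⟨hne, m, rfl⟩ := isFace_iff.1 hDA
  obtain ⟨t, rfl⟩ := h.exists_vadd_eq hC hD
  rw [dirFace_vadd] at hne hd ⊢
  rw [vectorSpan_vadd] at hd ⊢
  exact ⟨m, ⟨⟨C, hC, isFace_iff.2 ⟨(vadd_set_nonempty).1 hne, m, rfl⟩⟩, hd⟩, rfl⟩

/-- The witness `t` agrees with its mirror image in the center of `C`. -/
theorem exists_isCanonicalScaling_eq_of_parallel_dirFace (h : IsParallelohedronTiling P 𝒯)
    (hC : C ∈ 𝒯) (hs : IsCanonicalScaling 𝒯 s) :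
    ∃ t, IsCanonicalScaling 𝒯 t ∧
      ∀ (m m' : EuclideanSpace ℝ (Fin d)) (hm : dirFace C m ∈ hyperfaces 𝒯)
        (hm' : dirFace C m' ∈ hyperfaces 𝒯),
        vectorSpan ℝ (dirFace C m) = vectorSpan ℝ (dirFace C m') → t ⟨_, hm'⟩ = t ⟨_, hm⟩ := by
  obtain ⟨w, hwC, hw⟩ := h.exists_reflection hC
  obtain ⟨t, ht, htw⟩ := hs.exists_comp_reflection_eq hw
  refine ⟨t, ht, fun m m' hm hm' hparallel => ?_⟩
  rcases h.dirFace_eq_or_eq_reflection hC hwC hm hm' hparallel with heq | heq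
  · exact congrArg t (Subtype.ext heq)
  · exact htw _ _ heq

/-- The values on the facets of one cell are spread to all parallel hyperfaces; on the facets of
another cell the resulting scaling is then a translate of the given one. -/
theorem exists_eq_of_parallel_and_eq_on_cell (h : IsParallelohedronTiling P 𝒯)
    (hs : IsCanonicalScaling 𝒯 s) :
    ∃ s' : hyperfaces 𝒯 → ℝ, (∀ F, 0 < s' F) ∧
      (∀ F F' : hyperfaces 𝒯, vectorSpan ℝ F.1 = vectorSpan ℝ F'.1 → s' F = s' F') ∧
      ∀ D ∈ 𝒯, ∃ t, IsCanonicalScaling 𝒯 t ∧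
        ∀ (m : EuclideanSpace ℝ (Fin d)) (hm : dirFace D m ∈ hyperfaces 𝒯),
          t ⟨_, hm⟩ = s' ⟨_, hm⟩ := by
  obtain ⟨C, hC, -⟩ := h.exists_mem_cell 0
  obtain ⟨t, ht, htC⟩ := h.exists_isCanonicalScaling_eq_of_parallel_dirFace hC hs
  choose μ hμ hparallel using fun F : hyperfaces 𝒯 =>
    h.exists_dirFace_mem_hyperfaces_vectorSpan_eq hC F.2
  refine ⟨fun F => t ⟨_, hμ F⟩, fun F => ht.1 _, fun F F' hFF' => ?_, fun D hD => ?_⟩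
  · exact htC _ _ _ _ ((hparallel F').symm.trans (hFF'.symm.trans (hparallel F)))
  · obtain ⟨v, hv, rfl⟩ := h.exists_mem_stabilizer_vadd_eq hD hC
    refine ⟨t ∘ (isSymmetry_constVAdd hv).hyperfaceEquiv,
      (isSymmetry_constVAdd hv).isCanonicalScaling_comp ht, fun m hm => ?_⟩
    have hface : v +ᵥ dirFace D m = dirFace (v +ᵥ D) m := (dirFace_vadd D m v).symm
    have hmem : dirFace (v +ᵥ D) m ∈ hyperfaces 𝒯 :=
      hface ▸ (isSymmetry_constVAdd hv).image_mem_facesOfCodim hm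
    refine (congrArg t (Subtype.ext hface : _ = ⟨_, hmem⟩)).trans (htC _ _ _ _ ?_)
    rw [← hparallel, ← hface, vectorSpan_vadd]

theorem isCanonicalScaling_of_eq_on_cell (h : IsParallelohedronTiling P 𝒯)
    {s : hyperfaces 𝒯 → ℝ} (hpos : ∀ F, 0 < s F)
    (hparallel : ∀ F F' : hyperfaces 𝒯, vectorSpan ℝ F.1 = vectorSpan ℝ F'.1 → s F = s F')
    (hcell : ∀ D ∈ 𝒯, ∃ t, IsCanonicalScaling 𝒯 t ∧
      ∀ (m : EuclideanSpace ℝ (Fin d)) (hm : dirFace D m ∈ hyperfaces 𝒯),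
        t ⟨_, hm⟩ = s ⟨_, hm⟩) :
    IsCanonicalScaling 𝒯 s := by
  refine ⟨hpos, fun G hG => ?_⟩
  obtain ⟨C, hC, -⟩ := h.exists_mem_cell 0
  obtain ⟨t, ht, -⟩ := hcell C hC
  obtain ⟨_, e, he, ν, hν⟩ := (ht.2 G hG).exists_traversalNormal
  have := Fintype.ofFinite (hyperfacesAround 𝒯 G)
  obtain ⟨next, hfan, hconsecutive⟩ := h.exists_isPlaneFan hG he hν
  refine (isTorsion_zero_iff hG he hν).2 (hfan.sum_smul_eq_zero (fun A => (hpos A.1).ne') ?_ ?_)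
  · intro A B hopp
    refine hparallel _ _ (vectorSpan_eq_of_mem_orthogonal B.1.2 A.1.2 (hν A).ne_zero ?_
      (hν A).normal)
    rw [← neg_neg (ν A), ← hopp]
    exact neg_mem (hν B).normal
  · intro A
    obtain ⟨D, hc⟩ := hconsecutive A
    obtain ⟨t, ht, htD⟩ := hcell D hc.mem
    refine ⟨fun B => t B.1, (isTorsion_zero_iff hG he hν).1 (ht.2 G hG), ?_, ?_⟩
    · convert htD (-ν A) (hc.left_eq ▸ hc.left_mem) <;> exact hc.left_eq
    · convert htD (ν (next A)) (hc.right_eq ▸ hc.right_mem) <;> exact hc.right_eq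

theorem exists_isCanonicalScaling_eq_of_parallel (h : IsParallelohedronTiling P 𝒯)
    (hs : IsCanonicalScaling 𝒯 s) :
    ∃ s', IsCanonicalScaling 𝒯 s' ∧
      ∀ F F' : hyperfaces 𝒯, vectorSpan ℝ F.1 = vectorSpan ℝ F'.1 → s' F = s' F' := by
  obtain ⟨s', hpos, hparallel, hcell⟩ := h.exists_eq_of_parallel_and_eq_on_cell hs
  exact ⟨s', h.isCanonicalScaling_of_eq_on_cell hpos hparallel hcell, hparallel⟩

end IsParallelohedronTiling

end ParallelHyperfaces

end Parallelohedra

theorem mainTheorem6 {d : ℕ} (P : Set (EuclideanSpace ℝ (Fin d)))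
    (𝒯 : Set (Set (EuclideanSpace ℝ (Fin d))))
    (h𝒯 : Parallelohedra.IsParallelohedronTiling P 𝒯)
    (hs : ∃ s : Parallelohedra.hyperfaces 𝒯 → ℝ, Parallelohedra.IsCanonicalScaling 𝒯 s) :
    ∃ s' : Parallelohedra.hyperfaces 𝒯 → ℝ,
      Parallelohedra.IsCanonicalScaling 𝒯 s' ∧ Parallelohedra.IsTranslationInvariant 𝒯 s' := by
  obtain ⟨s, hs⟩ := hs
  obtain ⟨s', hs', hparallel⟩ := h𝒯.exists_isCanonicalScaling_eq_of_parallel hs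
  refine ⟨s', hs', fun v _ F F' hFF' => hparallel F' F ?_⟩
  rw [hFF', vectorSpan_vadd]
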